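/- Let $\mathbb F\in\{\mathbb R,\mathbb C\}$ and $0<p,q\le\infty$. Write $\ell_r$ ($0<r<\infty$) for the usual quasi-Banach space of $r$-summable scalar sequences, and use the convention that $\ell_\infty$ means $c_0$ and that $\ell_\infty$-sums of spaces are taken in the $c_0$-sense. Put $$Z_{p,q}=\ell_q(\ell_p),\qquad D_{p,q}=\ell_p\oplus\ell_q,\qquad B_{p,q}=\Bigl(\bigoplus_{n=1}^\infty \ell_p^n\Bigr)_q .$$ A symmetric sequence space is a quasi-Banach space $\mathbb S\subseteq\mathbb F^{\mathbb N}$ that contains the unit vectors $e_n$ and satisfies $\|(\varepsilon_n a_{\pi(n)})_n\|=\|(a_n)_n\|$ for all $(a_n)_n\in\mathbb S$, all permutations $\pi$ of $\mathbb N$ and all scalars $|\varepsilon_n|=1$; set $\Lambda_m[\mathbb S]=\|\sum_{n=1}^m e_n\|$. A sequence $(x_n)_{n=1}^\infty$ in a quasi-Banach space $\mathbb X$ is squeeze-symmetric if there are $x_n^*\in\mathbb X^*$ with $x_n^*(x_k)=\delta_{n,k}$ and symmetric sequence spaces $\mathbb S_1,\mathbb S_2$ such that $(a_n)_n\mapsto\sum_{n=1}^\infty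 a_nx_n$ is a bounded map from $\mathbb S_1$ into $\mathbb X$, $f\mapsto(x_n^*(f))_n$ is a bounded map from $\mathbb X$ into $\mathbb S_2$, and $\Lambda_m[\mathbb S_1]\approx\Lambda_m[\mathbb S_2]$ for $m\in\mathbb N$. The fundamental function of $\mathcal X=(x_n)_{n=1}^\infty$ is $$\varphi[\mathcal X,\mathbb X](m)=\sup\Bigl\{\Bigl\|\sum_{n\in A}\varepsilon_nx_n\Bigr\| : A\subseteq\mathbb N,\ |A|\le m,\ |\varepsilon_n|=1\Bigr\}.$$ **Theorem.** If $\mathcal X$ is a squeeze-symmetric sequence in $Z_{p,q}$, then there is $r\in\{p,q\}$ such that $$\varphi[\mathcal X,Z_{p,q}](m)\approx m^{1/r},\qquad m\in\mathbb N,$$ that is, $c\,m^{1/r}\le\varphi[\mathcal X,Z_{p,q}](m)\le C\,m^{1/r}$ for all $m\ge1$ with constants $0<c\le C<\infty$ independent of $m$ (where $1/\infty=0$). Moreover, $D_{p,q}$ and $B_{p,q}$ are isomorphic to complemented subspaces of $Z_{p,q}$, and the same conclusion holds for every squeeze-symmetric sequence in $D_{p,q}$ and for every squeeze-symmetric sequence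 in $B_{p,q}$. -/

import Mathlib

open Filter Topology
open scoped ENNReal

noncomputable section

namespace SqueezeSym

/-! ### Quasi-norms and quasi-Banach spaces -/

/-- `N` is a quasi-norm on the `𝕜`-vector space `V`. -/
structure IsQuasiNorm (𝕜 : Type*) [RCLike 𝕜] {V : Type*} [AddCommGroup V] [Module 𝕜 V]
    (N : V → ℝ) : Prop where
  nonneg : ∀ x, 0 ≤ N x
  eq_zero_iff : ∀ x, N x = 0 ↔ x = 0
  smul : ∀ (c : 𝕜) (x : V), N (c • x) = ‖c‖ * N x
  add_le : ∃ κ : ℝ, ∀ x y, N (x + y) ≤ κ * (N x + N y)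

/-- `(V, N)` is a quasi-Banach space: `N` is a quasi-norm for which every Cauchy sequence
converges. -/
structure IsQuasiBanach (𝕜 : Type*) [RCLike 𝕜] {V : Type*} [AddCommGroup V] [Module 𝕜 V]
    (N : V → ℝ) : Prop extends IsQuasiNorm 𝕜 N where
  complete : ∀ u : ℕ → V,
    (∀ δ : ℝ, 0 < δ → ∃ n₀ : ℕ, ∀ m n : ℕ, n₀ ≤ m → n₀ ≤ n → N (u m - u n) < δ) →
      ∃ x : V, Tendsto (fun n => N (u n - x)) atTop (𝓝 0)

/-! ### Symmetric sequence spaces and squeeze-symmetric sequences -/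

/-- A symmetric sequence space: a quasi-Banach space of scalar sequences which contains the unit
vectors and whose quasi-norm is invariant under permutations of the coordinates and under
multiplication of the coordinates by scalars of modulus one. (The unit vectors are not required
to span a dense subspace, so that weak Lorentz spaces are symmetric sequence spaces.) -/
structure SymmetricSeqSpace (𝕜 : Type*) [RCLike 𝕜] where
  carrier : Submodule 𝕜 (ℕ → 𝕜)
  qnorm : carrier → ℝ
  isQuasiBanach : IsQuasiBanach 𝕜 qnorm
  single_mem : ∀ n : ℕ, (Pi.single n (1 : 𝕜) : ℕ → 𝕜) ∈ carrier
  symmetric : ∀ (f : carrier) (ε : ℕ → 𝕜) (π : Equiv.Perm ℕ), (∀ n, ‖ε n‖ = 1) →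
    ∃ h : (fun n => ε n * (f : ℕ → 𝕜) (π n)) ∈ carrier, qnorm ⟨_, h⟩ = qnorm f

/-- The fundamental function `Λ_m[S]`, the quasi-norm of the sum of `m` unit vectors. -/
def SymmetricSeqSpace.fundamental {𝕜 : Type*} [RCLike 𝕜] (S : SymmetricSeqSpace 𝕜) (m : ℕ) : ℝ :=
  S.qnorm (∑ n ∈ Finset.range m, (⟨Pi.single n 1, S.single_mem n⟩ : S.carrier))

section General

variable {𝕜 V : Type*} [RCLike 𝕜] [AddCommGroup V]

/-- `(x, x')` is a biorthogonal system in the quasi-normed space `(V, N)`: the `x' n` are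
continuous linear functionals and `x' n (x k) = δ_{n,k}`. -/
def IsBiorthogonal [Module 𝕜 V] (N : V → ℝ) (x : ℕ → V) (x' : ℕ → V →ₗ[𝕜] 𝕜) : Prop :=
  (∀ n, ∃ C : ℝ, ∀ f, ‖x' n f‖ ≤ C * N f) ∧ ∀ n k, x' n (x k) = if n = k then 1 else 0

/-- `(V, N)` is squeezed between `S₁` and `S₂` via `(x, x')`: the series transform
`a ↦ ∑ n, a n • x n` is (defined and) bounded from `S₁` into `V`, and the coefficient transform
`f ↦ (x' n f)_n` is (defined and) bounded from `V` into `S₂`. -/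
def IsSqueezed [Module 𝕜 V] (N : V → ℝ) (x : ℕ → V) (x' : ℕ → V →ₗ[𝕜] 𝕜)
    (S₁ S₂ : SymmetricSeqSpace 𝕜) : Prop :=
  (∃ C : ℝ, ∀ a : S₁.carrier, ∃ f : V,
    Tendsto (fun k : ℕ => N (f - ∑ n ∈ Finset.range k, (a : ℕ → 𝕜) n • x n)) atTop (𝓝 0) ∧
      N f ≤ C * S₁.qnorm a) ∧
  ∃ C : ℝ, ∀ f : V, ∃ h : (fun n => x' n f) ∈ S₂.carrier, S₂.qnorm ⟨_, h⟩ ≤ C * N f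

/-- The sequence `x` in the quasi-normed space `(V, N)` is squeeze-symmetric. -/
def IsSqueezeSymmetric (𝕜 : Type*) [RCLike 𝕜] [Module 𝕜 V] (N : V → ℝ) (x : ℕ → V) : Prop :=
  ∃ x' : ℕ → V →ₗ[𝕜] 𝕜, IsBiorthogonal N x x' ∧
    ∃ S₁ S₂ : SymmetricSeqSpace 𝕜, IsSqueezed N x x' S₁ S₂ ∧
      ∃ c C : ℝ, 0 < c ∧ 0 < C ∧ ∀ m : ℕ, 1 ≤ m →
        c * S₂.fundamental m ≤ S₁.fundamental m ∧ S₁.fundamental m ≤ C * S₂.fundamental m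

/-- The fundamental function (upper super-democracy function) of the sequence `x`: the supremum
of `N (∑ n ∈ A, ε n • x n)` over `|A| ≤ m` and scalars `ε n` of modulus one. -/
def fundamentalFun (𝕜 : Type*) [RCLike 𝕜] [Module 𝕜 V] (N : V → ℝ) (x : ℕ → V) (m : ℕ) : ℝ≥0∞ :=
  ⨆ (A : Finset ℕ) (_ : A.card ≤ m) (ε : ℕ → 𝕜) (_ : ∀ n, ‖ε n‖ = 1),
    ENNReal.ofReal (N (∑ n ∈ A, ε n • x n))

/-- `φ(m) ≈ m ^ (1 / r)` for `m ≥ 1`, where `1 / ∞ = 0`. -/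
def GrowsAsPower (φ : ℕ → ℝ≥0∞) (r : ℝ≥0∞) : Prop :=
  ∃ c C : ℝ, 0 < c ∧ 0 < C ∧ ∀ m : ℕ, 1 ≤ m →
    ENNReal.ofReal (c * (m : ℝ) ^ (r⁻¹).toReal) ≤ φ m ∧
      φ m ≤ ENNReal.ofReal (C * (m : ℝ) ^ (r⁻¹).toReal)

/-- `(V, N)` is isomorphic to a complemented subspace of `(W, M)`. -/
def IsComplementedIn (𝕜 : Type*) [RCLike 𝕜] [Module 𝕜 V] {W : Type*} [AddCommGroup W] [Module 𝕜 W]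
    (N : V → ℝ) (M : W → ℝ) : Prop :=
  ∃ (J : V →ₗ[𝕜] W) (P : W →ₗ[𝕜] V) (C : ℝ),
    (∀ v, M (J v) ≤ C * N v) ∧ (∀ w, N (P w) ≤ C * M w) ∧ ∀ v, P (J v) = v

end General

/-! ### The spaces `ℓ_r`, with the convention that `ℓ_∞` means `c₀` -/

/-- Membership in `ℓ_r` (`0 < r < ∞`), respectively in `c₀` (`r = ∞`). -/
def MemEll {ι E : Type*} [NormedAddCommGroup E] (r : ℝ≥0∞) (f : ι → E) : Prop :=
  if r = ∞ then Tendsto f cofinite (𝓝 0) else Summable fun i => ‖f i‖ ^ r.toReal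

/-- The quasi-norm of `ℓ_r`. -/
def ellNorm {ι E : Type*} [NormedAddCommGroup E] (r : ℝ≥0∞) (f : ι → E) : ℝ :=
  if r = ∞ then ⨆ i, ‖f i‖ else (∑' i, ‖f i‖ ^ r.toReal) ^ (1 / r.toReal)

section Ell

variable {ι E : Type*} [NormedAddCommGroup E] {r : ℝ≥0∞}

theorem ellNorm_nonneg (r : ℝ≥0∞) (f : ι → E) : 0 ≤ ellNorm r f := by
  unfold ellNorm
  split_ifs
  · exact Real.iSup_nonneg fun i => norm_nonneg _
  · exact Real.rpow_nonneg (tsum_nonneg fun i => Real.rpow_nonneg (norm_nonneg _) _) _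

theorem bddAbove_of_tendsto {f : ι → E} (hf : Tendsto f cofinite (𝓝 0)) :
    BddAbove (Set.range fun i => ‖f i‖) := by
  have h1 : ∀ᶠ i in cofinite, ‖f i‖ < 1 := by
    have := hf.norm
    rw [norm_zero] at this
    exact this.eventually (gt_mem_nhds one_pos)
  have h2 : Set.Finite {i | ¬ ‖f i‖ < 1} := h1
  obtain ⟨B, hB⟩ := (h2.image fun i => ‖f i‖).bddAbove
  refine ⟨max 1 B, ?_⟩
  rintro _ ⟨i, rfl⟩
  by_cases hi : ‖f i‖ < 1
  · exact hi.le.trans (le_max_left _ _)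
  · exact (hB ⟨i, hi, rfl⟩).trans (le_max_right _ _)

theorem rpow_add_le {s a b : ℝ} (hs : 0 < s) (ha : 0 ≤ a) (hb : 0 ≤ b) :
    (a + b) ^ s ≤ 2 ^ s * (a ^ s + b ^ s) := by
  have h : a + b ≤ 2 * max a b := by
    have := le_max_left a b
    have := le_max_right a b
    linarith
  calc (a + b) ^ s ≤ (2 * max a b) ^ s := Real.rpow_le_rpow (by positivity) h hs.le
    _ = 2 ^ s * (max a b) ^ s := Real.mul_rpow (by positivity) (by positivity)
    _ ≤ 2 ^ s * (a ^ s + b ^ s) := by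
      gcongr
      rcases max_cases a b with ⟨h, -⟩ | ⟨h, -⟩ <;> rw [h]
      · exact le_add_of_nonneg_right (Real.rpow_nonneg hb _)
      · exact le_add_of_nonneg_left (Real.rpow_nonneg ha _)

theorem MemEll.of_le {F : Type*} [NormedAddCommGroup F] (hr : 0 < r) {f : ι → E} {g : ι → F}
    (hg : MemEll r g) (h : ∀ i, ‖f i‖ ≤ ‖g i‖) : MemEll r f := by
  unfold MemEll at *
  split_ifs at * with hi
  · exact squeeze_zero_norm h (by simpa using hg.norm)
  · have hs : 0 < r.toReal := ENNReal.toReal_pos hr.ne' hi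
    exact hg.of_nonneg_of_le (fun i => by positivity)
      fun i => Real.rpow_le_rpow (norm_nonneg _) (h i) hs.le

theorem MemEll.zero (hr : 0 < r) : MemEll r (0 : ι → E) := by
  unfold MemEll
  split_ifs with hi
  · exact tendsto_const_nhds
  · have hs : 0 < r.toReal := ENNReal.toReal_pos hr.ne' hi
    simp [Real.zero_rpow hs.ne', summable_zero]

theorem MemEll.add (hr : 0 < r) {f g : ι → E} (hf : MemEll r f) (hg : MemEll r g) :
    MemEll r (f + g) := by
  unfold MemEll at *
  split_ifs at * with hi
  · have h := Filter.Tendsto.add hf hg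
    rw [add_zero] at h
    exact h
  · have hs : 0 < r.toReal := ENNReal.toReal_pos hr.ne' hi
    refine ((hf.add hg).mul_left (2 ^ r.toReal)).of_nonneg_of_le (fun i => by positivity) fun i => ?_
    exact (Real.rpow_le_rpow (norm_nonneg _) (norm_add_le _ _) hs.le).trans
      (rpow_add_le hs (norm_nonneg _) (norm_nonneg _))

theorem MemEll.smul {𝕜 : Type*} [RCLike 𝕜] [NormedSpace 𝕜 E] (_hr : 0 < r) (c : 𝕜) {f : ι → E}
    (hf : MemEll r f) : MemEll r (c • f) := by
  unfold MemEll at *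
  split_ifs at * with hi
  · have h := Filter.Tendsto.const_smul hf c
    rw [smul_zero] at h
    exact h
  · refine (hf.mul_left (‖c‖ ^ r.toReal)).congr fun i => ?_
    rw [Pi.smul_apply, norm_smul, Real.mul_rpow (norm_nonneg _) (norm_nonneg _)]

theorem ellNorm_zero (hr : 0 < r) : ellNorm r (0 : ι → E) = 0 := by
  unfold ellNorm
  split_ifs with hi
  · simp
  · have hs : 0 < r.toReal := ENNReal.toReal_pos hr.ne' hi
    simp [Real.zero_rpow hs.ne', hs.ne']

theorem ellNorm_smul {𝕜 : Type*} [RCLike 𝕜] [NormedSpace 𝕜 E] (hr : 0 < r) (c : 𝕜) (f : ι → E) :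
    ellNorm r (c • f) = ‖c‖ * ellNorm r f := by
  unfold ellNorm
  split_ifs with hi
  · simp only [Pi.smul_apply, norm_smul]
    rw [Real.mul_iSup_of_nonneg (norm_nonneg c)]
  · have hs : 0 < r.toReal := ENNReal.toReal_pos hr.ne' hi
    simp only [Pi.smul_apply, norm_smul, Real.mul_rpow (norm_nonneg _) (norm_nonneg _)]
    rw [tsum_mul_left, Real.mul_rpow (by positivity) (tsum_nonneg fun i => by positivity),
      ← Real.rpow_mul (norm_nonneg _), mul_one_div_cancel hs.ne', Real.rpow_one]

/-- The quasi-triangle inequality in `ℓ_r`, with a constant depending only on `r`. -/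
theorem exists_ellNorm_add_le (hr : 0 < r) : ∃ K : ℝ, 0 ≤ K ∧ ∀ (ι : Type) (E : Type _)
    [NormedAddCommGroup E] (f g : ι → E), MemEll r f → MemEll r g →
      ellNorm r (f + g) ≤ K * (ellNorm r f + ellNorm r g) := by
  by_cases hi : r = ∞
  · refine ⟨1, zero_le_one, fun ι E _ f g hf hg => ?_⟩
    simp only [ellNorm, MemEll, hi, if_true] at *
    rw [one_mul]
    have hf' := bddAbove_of_tendsto hf
    have hg' := bddAbove_of_tendsto hg
    refine Real.iSup_le (fun i => ?_) (add_nonneg (Real.iSup_nonneg fun i => norm_nonneg _)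
      (Real.iSup_nonneg fun i => norm_nonneg _))
    exact (norm_add_le _ _).trans (add_le_add (le_ciSup hf' i) (le_ciSup hg' i))
  · have hs : 0 < r.toReal := ENNReal.toReal_pos hr.ne' hi
    have hs' : 0 < 1 / r.toReal := by positivity
    refine ⟨2 * 2 ^ (1 / r.toReal), by positivity, fun ι E _ f g hf hg => ?_⟩
    have hfg := MemEll.add hr hf hg
    simp only [ellNorm, MemEll, hi, if_false] at *
    have hA : 0 ≤ ∑' i, ‖f i‖ ^ r.toReal := tsum_nonneg fun i => by positivity
    have hB : 0 ≤ ∑' i, ‖g i‖ ^ r.toReal := tsum_nonneg fun i => by positivity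
    have key : ∑' i, ‖(f + g) i‖ ^ r.toReal
        ≤ 2 ^ r.toReal * (∑' i, ‖f i‖ ^ r.toReal + ∑' i, ‖g i‖ ^ r.toReal) := by
      rw [← hf.tsum_add hg, ← tsum_mul_left]
      refine hfg.tsum_le_tsum (fun i => ?_) ((hf.add hg).mul_left _)
      exact (Real.rpow_le_rpow (norm_nonneg _) (norm_add_le _ _) hs.le).trans
        (rpow_add_le hs (norm_nonneg _) (norm_nonneg _))
    calc (∑' i, ‖(f + g) i‖ ^ r.toReal) ^ (1 / r.toReal)
        ≤ (2 ^ r.toReal * (∑' i, ‖f i‖ ^ r.toReal + ∑' i, ‖g i‖ ^ r.toReal)) ^ (1 / r.toReal) :=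
          Real.rpow_le_rpow (tsum_nonneg fun i => by positivity) key hs'.le
      _ = 2 * (∑' i, ‖f i‖ ^ r.toReal + ∑' i, ‖g i‖ ^ r.toReal) ^ (1 / r.toReal) := by
          rw [Real.mul_rpow (by positivity) (by positivity), ← Real.rpow_mul (by positivity),
            mul_one_div_cancel hs.ne', Real.rpow_one]
      _ ≤ 2 * (2 ^ (1 / r.toReal) * ((∑' i, ‖f i‖ ^ r.toReal) ^ (1 / r.toReal)
            + (∑' i, ‖g i‖ ^ r.toReal) ^ (1 / r.toReal))) := by
          gcongr
          exact rpow_add_le hs' hA hB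
      _ = _ := by ring

end Ell

/-! ### The spaces `Z_{p,q}`, `B_{p,q}` and `D_{p,q}` -/

section Spaces

variable (𝕜 : Type*) [RCLike 𝕜] {p q : ℝ≥0∞}

/-- The space `ℓ_r` (`c₀` if `r = ∞`). -/
def ellSpace {r : ℝ≥0∞} (hr : 0 < r) : Submodule 𝕜 (ℕ → 𝕜) where
  carrier := {f | MemEll r f}
  zero_mem' := MemEll.zero hr
  add_mem' := fun hf hg => MemEll.add hr hf hg
  smul_mem' := fun c _ hf => MemEll.smul hr c hf

/-- The direct sum `(⨁ n, ℓ_p(κ n))_q` in the sense of `ℓ_q` (in the sense of `c₀` if `q = ∞`). -/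
def mixedSpace (κ : ℕ → Type) (hp : 0 < p) (hq : 0 < q) :
    Submodule 𝕜 ((n : ℕ) → κ n → 𝕜) where
  carrier := {f | (∀ n, MemEll p (f n)) ∧ MemEll q fun n => ellNorm p (f n)}
  zero_mem' := by
    refine ⟨fun n => MemEll.zero hp, ?_⟩
    have : (fun n => ellNorm p ((0 : (n : ℕ) → κ n → 𝕜) n)) = 0 := by
      funext n
      exact ellNorm_zero hp
    rw [this]
    exact MemEll.zero hq
  add_mem' := by
    rintro f g ⟨hf, hf'⟩ ⟨hg, hg'⟩
    refine ⟨fun n => MemEll.add hp (hf n) (hg n), ?_⟩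
    obtain ⟨K, hK, h⟩ := exists_ellNorm_add_le hp
    refine MemEll.of_le hq (MemEll.smul (𝕜 := ℝ) hq K (MemEll.add hq hf' hg')) fun n => ?_
    rw [Real.norm_of_nonneg (ellNorm_nonneg _ _)]
    exact (h _ _ _ _ (hf n) (hg n)).trans (le_abs_self _)
  smul_mem' := by
    rintro c f ⟨hf, hf'⟩
    refine ⟨fun n => MemEll.smul hp c (hf n), ?_⟩
    refine MemEll.of_le hq (MemEll.smul (𝕜 := ℝ) hq ‖c‖ hf') fun n => ?_
    have : ellNorm p ((c • f) n) = ‖c‖ * ellNorm p (f n) := ellNorm_smul hp c (f n)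
    rw [this]
    rfl

/-- The quasi-norm of `(⨁ n, ℓ_p(κ n))_q`. -/
def mixedNorm {κ : ℕ → Type} (hp : 0 < p) (hq : 0 < q) (f : mixedSpace 𝕜 κ hp hq) : ℝ :=
  ellNorm q fun n => ellNorm p ((f : (n : ℕ) → κ n → 𝕜) n)

/-- The matrix space `Z_{p,q} = ℓ_q(ℓ_p)`. -/
abbrev Z (hp : 0 < p) (hq : 0 < q) : Submodule 𝕜 (ℕ → ℕ → 𝕜) :=
  mixedSpace 𝕜 (fun _ => ℕ) hp hq

/-- The quasi-norm of `Z_{p,q}`. -/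
abbrev normZ (hp : 0 < p) (hq : 0 < q) : Z 𝕜 hp hq → ℝ :=
  mixedNorm 𝕜 hp hq

/-- The space `B_{p,q} = (⨁_{n ≥ 1} ℓ_p^n)_q`, with the summand `ℓ_p^n` at index `n - 1`. -/
abbrev B (hp : 0 < p) (hq : 0 < q) : Submodule 𝕜 ((n : ℕ) → Fin (n + 1) → 𝕜) :=
  mixedSpace 𝕜 (fun n => Fin (n + 1)) hp hq

/-- The quasi-norm of `B_{p,q}`. -/
abbrev normB (hp : 0 < p) (hq : 0 < q) : B 𝕜 hp hq → ℝ :=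
  mixedNorm 𝕜 hp hq

/-- The direct sum `D_{p,q} = ℓ_p ⊕ ℓ_q`. -/
abbrev D (hp : 0 < p) (hq : 0 < q) : Submodule 𝕜 ((ℕ → 𝕜) × (ℕ → 𝕜)) :=
  (ellSpace 𝕜 hp).prod (ellSpace 𝕜 hq)

/-- The quasi-norm of `D_{p,q}` (the maximum of the quasi-norms of the two components). -/
def normD (hp : 0 < p) (hq : 0 < q) (f : D 𝕜 hp hq) : ℝ :=
  max (ellNorm p f.1.1) (ellNorm q f.1.2)

end Spaces

end SqueezeSym

end

noncomputable section

namespace SqueezeSym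

/-! ### Extended `ℓ_r` quasi-norms of nonnegative functions -/

/-! Squeezing makes every signed sum of `m` distinct terms of the sequence have quasi-norm
comparable to one number `Λ m`, the fundamental function of a symmetric space
(`IsSqueezeSymmetric.exists_fundamental`). The growth may therefore be computed on whatever
subsequence or differences are convenient.

The terms are bounded, so a subsequence converges coordinatewise; its consecutive differences are
coordinatewise null, and since `Λ (2m) ≈ Λ m` their sums still grow like `Λ`. By a gliding hump
(`exists_disjoint_blocks`) a subsequence of the differences is a small perturbation of finitely and
disjointly supported matrices `u k`. Within each row the `ℓ_p` norms of disjoint vectors combine in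
`ℓ_p`, so the norm of a sum of the `u k` is the `ℓ_q(ℓ_p)` norm of an array whose columns are the
row-norm sequences `a k`: a semi-normalized sequence of finitely supported nonnegative vectors of
`ℓ_q`.

The heart is a dichotomy for such columns (`exists_subseq_isPowerLike`). If `p ≤ q`, either every
row tends to zero, and then a subsequence lives essentially in disjoint sets of rows and grows like
`m ^ (1/q)`, or some row stays large along a subsequence and Minkowski's inequality gives `m ^
(1/p)`. If `q < p`, either mass escapes to infinity, and escaping tails force `m ^ (1/q)`, or the
columns are uniformly tight, and then a subsequence is dominated by a single vector of `ℓ_q`, which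
gives `m ^ (1/p)`.

Finally `D` sits in `Z` as the first row and first column, `B` as the lower triangle, both
complemented, and squeeze-symmetry passes from a complemented subspace to the whole space. -/

/-- The `ℓ_r` quasi-norm of a `[0, ∞]`-valued function. -/
def eell {ι : Type*} (r : ℝ≥0∞) (f : ι → ℝ≥0∞) : ℝ≥0∞ :=
  if r = ∞ then ⨆ i, f i else (∑' i, f i ^ r.toReal) ^ (1 / r.toReal)

section Eell

variable {ι κ : Type*} {p q r : ℝ≥0∞}

theorem eell_top (f : ι → ℝ≥0∞) : eell ∞ f = ⨆ i, f i := by simp [eell]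

theorem eell_of_ne_top (hr : r ≠ ∞) (f : ι → ℝ≥0∞) :
    eell r f = (∑' i, f i ^ r.toReal) ^ (1 / r.toReal) := by simp [eell, hr]

theorem eell_rpow (hr : 0 < r) (hr' : r ≠ ∞) (f : ι → ℝ≥0∞) :
    eell r f ^ r.toReal = ∑' i, f i ^ r.toReal := by
  have hs : 0 < r.toReal := ENNReal.toReal_pos hr.ne' hr'
  rw [eell_of_ne_top hr', ← ENNReal.rpow_mul, one_div_mul_cancel hs.ne', ENNReal.rpow_one]

theorem eell_mono {f g : ι → ℝ≥0∞} (h : ∀ i, f i ≤ g i) : eell r f ≤ eell r g := by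
  unfold eell
  split_ifs
  · exact iSup_mono h
  · gcongr with i
    exact h i

theorem le_eell (hr : 0 < r) (f : ι → ℝ≥0∞) (i : ι) : f i ≤ eell r f := by
  unfold eell
  split_ifs with hi
  · exact le_iSup f i
  · have hs : 0 < r.toReal := ENNReal.toReal_pos hr.ne' hi
    calc f i = (f i ^ r.toReal) ^ (1 / r.toReal) := by
          rw [← ENNReal.rpow_mul, mul_one_div_cancel hs.ne', ENNReal.rpow_one]
      _ ≤ _ := by
          gcongr
          exact ENNReal.le_tsum (f := fun i => f i ^ r.toReal) i

theorem eell_const_mul (hr : 0 < r) (c : ℝ≥0∞) (f : ι → ℝ≥0∞) :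
    eell r (fun i => c * f i) = c * eell r f := by
  unfold eell
  split_ifs with hi
  · rw [ENNReal.mul_iSup]
  · have hs : 0 < r.toReal := ENNReal.toReal_pos hr.ne' hi
    simp only [ENNReal.mul_rpow_of_nonneg _ _ hs.le]
    rw [ENNReal.tsum_mul_left, ENNReal.mul_rpow_of_nonneg _ _ (by positivity), ← ENNReal.rpow_mul,
      mul_one_div_cancel hs.ne', ENNReal.rpow_one]

theorem eell_eq_of_forall_ne (hr : 0 < r) {f : ι → ℝ≥0∞} (i : ι) (h : ∀ k, k ≠ i → f k = 0) :
    eell r f = f i := by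
  unfold eell
  split_ifs with hi
  · refine le_antisymm (iSup_le fun k => ?_) (le_iSup f i)
    by_cases hk : k = i
    · rw [hk]
    · simp [h k hk]
  · have hs : 0 < r.toReal := ENNReal.toReal_pos hr.ne' hi
    rw [tsum_eq_single i fun k hk => by rw [h k hk, ENNReal.zero_rpow_of_pos hs],
      ← ENNReal.rpow_mul, mul_one_div_cancel hs.ne', ENNReal.rpow_one]

theorem eell_eq_zero (hr : 0 < r) {f : ι → ℝ≥0∞} (h : ∀ i, f i = 0) : eell r f = 0 := by
  have := eell_const_mul hr 0 f
  simp only [zero_mul] at this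
  rw [← this]
  congr 1
  exact funext h

/-- With a single nonzero entry the exponent is irrelevant. This is what allows the inner `ℓ_p` to
be exchanged for `ℓ_q` when columns occupy disjoint sets of rows. -/
theorem eell_eq_eell_of_subsingleton (hp : 0 < p) (hq : 0 < q) {f : ι → ℝ≥0∞}
    (h : ∀ i j, f i ≠ 0 → f j ≠ 0 → i = j) : eell p f = eell q f := by
  by_cases h0 : ∀ i, f i = 0
  · rw [eell_eq_zero hp h0, eell_eq_zero hq h0]
  · push Not at h0
    obtain ⟨i, hi⟩ := h0
    have hk : ∀ k, k ≠ i → f k = 0 := fun k hk => by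
      by_contra hne
      exact hk (h k i hne hi)
    rw [eell_eq_of_forall_ne hp i hk, eell_eq_of_forall_ne hq i hk]

/-- A constant in the quasi-triangle inequality of `ℓ_r`. -/
def eellConst (r : ℝ≥0∞) : ℝ≥0∞ := 2 * 2 ^ (1 / r.toReal)

theorem eellConst_ne_top : eellConst r ≠ ∞ :=
  ENNReal.mul_ne_top (by simp) (ENNReal.rpow_ne_top_of_nonneg (by positivity) (by simp))

theorem one_le_eellConst : 1 ≤ eellConst r := by
  have h : (1 : ℝ≥0∞) ≤ 2 ^ (1 / r.toReal) := by
    simpa using ENNReal.rpow_le_rpow (z := 1 / r.toReal) one_le_two (by positivity)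
  calc (1 : ℝ≥0∞) = 1 * 1 := by simp
    _ ≤ _ := mul_le_mul' (by norm_num) h

theorem add_rpow_le_two {s : ℝ} (hs : 0 ≤ s) (a b : ℝ≥0∞) :
    (a + b) ^ s ≤ 2 ^ s * (a ^ s + b ^ s) := by
  have h : a + b ≤ 2 * max a b := by
    rw [two_mul]
    exact add_le_add (le_max_left _ _) (le_max_right _ _)
  calc (a + b) ^ s ≤ (2 * max a b) ^ s := ENNReal.rpow_le_rpow h hs
    _ = 2 ^ s * (max a b) ^ s := ENNReal.mul_rpow_of_nonneg _ _ hs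
    _ ≤ 2 ^ s * (a ^ s + b ^ s) := by
      gcongr
      rcases max_cases a b with ⟨h, -⟩ | ⟨h, -⟩ <;> rw [h]
      · exact le_self_add
      · exact le_add_self

theorem eell_add_le (hr : 0 < r) (f g : ι → ℝ≥0∞) :
    eell r (fun i => f i + g i) ≤ eellConst r * (eell r f + eell r g) := by
  by_cases hi : r = ∞
  · subst hi
    -- Here `∞.toReal = 0` and `1 / 0 = 0`, so the constant is 2; only that it is at least 1
    -- matters.
    refine le_trans ?_ (le_mul_of_one_le_left zero_le one_le_eellConst)
    simp only [eell_top]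
    exact iSup_le fun i => add_le_add (le_iSup f i) (le_iSup g i)
  · have hs : 0 < r.toReal := ENNReal.toReal_pos hr.ne' hi
    simp only [eell_of_ne_top hi]
    calc (∑' i, (f i + g i) ^ r.toReal) ^ (1 / r.toReal)
        ≤ (∑' i, 2 ^ r.toReal * (f i ^ r.toReal + g i ^ r.toReal)) ^ (1 / r.toReal) := by
          gcongr with i
          exact add_rpow_le_two hs.le _ _
      _ = 2 * (∑' i, f i ^ r.toReal + ∑' i, g i ^ r.toReal) ^ (1 / r.toReal) := by
          rw [ENNReal.tsum_mul_left, ENNReal.tsum_add,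
            ENNReal.mul_rpow_of_nonneg _ _ (by positivity), ← ENNReal.rpow_mul,
            mul_one_div_cancel hs.ne', ENNReal.rpow_one]
      _ ≤ 2 * (2 ^ (1 / r.toReal) * ((∑' i, f i ^ r.toReal) ^ (1 / r.toReal)
            + (∑' i, g i ^ r.toReal) ^ (1 / r.toReal))) := by
          gcongr
          exact add_rpow_le_two (by positivity) _ _
      _ = _ := by rw [eellConst, mul_assoc]

theorem eell_comm (hr : 0 < r) (f : ι → κ → ℝ≥0∞) :
    eell r (fun i => eell r fun k => f i k) = eell r fun k => eell r fun i => f i k := by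
  by_cases hi : r = ∞
  · subst hi
    simp only [eell_top]
    exact iSup_comm
  · rw [eell_of_ne_top hi, eell_of_ne_top hi (fun k => eell r fun i => f i k)]
    simp only [eell_rpow hr hi]
    rw [ENNReal.tsum_comm]

theorem eell_anti (hq : 0 < q) (hqp : q ≤ p) (f : ι → ℝ≥0∞) : eell p f ≤ eell q f := by
  by_cases hp' : p = ∞
  · subst hp'
    rw [eell_top]
    exact iSup_le fun i => le_eell hq f i
  · have hq' : q ≠ ∞ := ne_top_of_le_ne_top hp' hqp
    have hs : 0 < q.toReal := ENNReal.toReal_pos hq.ne' hq'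
    have ht : 0 < p.toReal := ENNReal.toReal_pos (hq.trans_le hqp).ne' hp'
    have hst : q.toReal ≤ p.toReal := ENNReal.toReal_mono hp' hqp
    have key : ∑' i, f i ^ p.toReal ≤ eell q f ^ p.toReal := by
      have e : ∀ x : ℝ≥0∞, x ^ p.toReal = x ^ (p.toReal - q.toReal) * x ^ q.toReal := fun x => by
        rw [← ENNReal.rpow_add_of_nonneg _ _ (by linarith) hs.le, sub_add_cancel]
      rw [e (eell q f), eell_rpow hq hq', ← ENNReal.tsum_mul_left]
      refine ENNReal.tsum_le_tsum fun i => ?_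
      rw [e (f i)]
      exact mul_le_mul' (ENNReal.rpow_le_rpow (le_eell hq f i) (by linarith)) le_rfl
    rw [eell_of_ne_top hp']
    calc (∑' i, f i ^ p.toReal) ^ (1 / p.toReal) ≤ (eell q f ^ p.toReal) ^ (1 / p.toReal) := by
          gcongr
      _ = eell q f := by
          rw [← ENNReal.rpow_mul, mul_one_div_cancel ht.ne', ENNReal.rpow_one]

/-- The triangle inequality of `L^s` for counting measure, iterated over `A`. -/
theorem tsum_rpow_finset_sum_le {s : ℝ} (hs : 1 ≤ s) (A : Finset κ) (f : κ → ℕ → ℝ≥0∞) :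
    (∑' i, (∑ k ∈ A, f k i) ^ s) ^ (1 / s) ≤ ∑ k ∈ A, (∑' i, f k i ^ s) ^ (1 / s) := by
  classical
  induction A using Finset.induction_on with
  | empty =>
    have : 0 < s := by linarith
    simp [ENNReal.zero_rpow_of_pos this, this]
  | insert k A hk ih =>
    simp only [Finset.sum_insert hk]
    refine le_trans ?_ (add_le_add le_rfl ih)
    have := ENNReal.lintegral_Lp_add_le (μ := MeasureTheory.Measure.count) (p := s)
      (f := f k) (g := fun i => ∑ k ∈ A, f k i) (measurable_of_countable _).aemeasurable
      (measurable_of_countable _).aemeasurable hs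
    simpa only [MeasureTheory.lintegral_count, Pi.add_apply] using this

/-- Minkowski's inequality for mixed norms. -/
theorem eell_eell_le (hp : 0 < p) (hpq : p ≤ q) {m : ℕ} (a : Fin m → ℕ → ℝ≥0∞) :
    eell q (fun j => eell p fun k => a k j) ≤ eell p fun k => eell q (a k) := by
  by_cases hq' : q = ∞
  · subst hq'
    rw [eell_top]
    exact iSup_le fun j => eell_mono fun k => le_eell (hp.trans_le hpq) (a k) j
  · have hp' : p ≠ ∞ := ne_top_of_le_ne_top hq' hpq
    have hq : 0 < q := hp.trans_le hpq
    have hs : 0 < p.toReal := ENNReal.toReal_pos hp.ne' hp'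
    have ht : 0 < q.toReal := ENNReal.toReal_pos hq.ne' hq'
    have hst : 1 ≤ q.toReal / p.toReal := by
      rw [le_div_iff₀ hs, one_mul]
      exact ENNReal.toReal_mono hq' hpq
    -- The triangle inequality with exponent `q / p ≥ 1`, applied to the `p`-th powers.
    have key := tsum_rpow_finset_sum_le hst Finset.univ fun (k : Fin m) j => a k j ^ p.toReal
    have e1 : ∀ x : ℝ≥0∞, (x ^ p.toReal) ^ (q.toReal / p.toReal) = x ^ q.toReal := fun x => by
      rw [← ENNReal.rpow_mul]
      congr 1
      field_simp
    have e2 : ∀ x : ℝ≥0∞, x ^ (1 / (q.toReal / p.toReal)) = (x ^ (1 / q.toReal)) ^ p.toReal :=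
      fun x => by
        rw [← ENNReal.rpow_mul]
        congr 1
        field_simp
    simp only [e1, e2] at key
    rw [eell_of_ne_top hp', tsum_fintype]
    have := ENNReal.rpow_le_rpow key (z := 1 / p.toReal) (by positivity)
    rw [← ENNReal.rpow_mul _ p.toReal, mul_one_div_cancel hs.ne', ENNReal.rpow_one] at this
    convert this using 1
    · rw [eell_of_ne_top hq']
      congr 1
      refine tsum_congr fun j => ?_
      rw [eell_of_ne_top hp', tsum_fintype, ← ENNReal.rpow_mul]
      congr 1
      field_simp
    · simp only [eell_of_ne_top hq']

theorem eell_fin_const (hr : 0 < r) {m : ℕ} (hm : 1 ≤ m) (c : ℝ≥0∞) :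
    eell r (fun _ : Fin m => c) = (m : ℝ≥0∞) ^ (r⁻¹).toReal * c := by
  have : Nonempty (Fin m) := ⟨⟨0, hm⟩⟩
  unfold eell
  split_ifs with hi
  · simp [hi]
  · have hs : 0 < r.toReal := ENNReal.toReal_pos hr.ne' hi
    rw [tsum_fintype, Finset.sum_const, Finset.card_univ, Fintype.card_fin, nsmul_eq_mul,
      ENNReal.mul_rpow_of_nonneg _ _ (by positivity), ← ENNReal.rpow_mul,
      mul_one_div_cancel hs.ne', ENNReal.rpow_one, ENNReal.toReal_inv, one_div]

theorem eell_comp_le_of_injective {e : κ → ι} (he : Function.Injective e) (f : ι → ℝ≥0∞) :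
    eell r (fun k => f (e k)) ≤ eell r f := by
  unfold eell
  split_ifs
  · exact iSup_le fun k => le_iSup f (e k)
  · gcongr
    exact ENNReal.tsum_comp_le_tsum_of_injective he fun i => f i ^ r.toReal

/-- There is a positive nonincreasing sequence of `ℓ_r` quasi-norm at most one. -/
theorem exists_eell_le_one (r : ℝ≥0∞) (hr : 0 < r) :
    ∃ δ : ℕ → ℝ≥0∞, (∀ k, 0 < δ k) ∧ Antitone δ ∧ eell r δ ≤ 1 := by
  by_cases hi : r = ∞
  · exact ⟨fun _ => 1, fun _ => one_pos, antitone_const, by simp [eell, hi]⟩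
  · have hs : 0 < r.toReal := ENNReal.toReal_pos hr.ne' hi
    refine ⟨fun k => (2⁻¹ ^ (k + 1)) ^ (1 / r.toReal), fun k => ?_,
      fun k l hkl => ?_, ?_⟩
    · exact ENNReal.rpow_pos (ENNReal.pow_pos (by simp) _) (ENNReal.pow_ne_top (by simp))
    · exact ENNReal.rpow_le_rpow (pow_le_pow_right_of_le_one' (by simp) (by omega)) (by positivity)
    · rw [eell_of_ne_top hi]
      simp only [← ENNReal.rpow_mul, one_div_mul_cancel hs.ne', ENNReal.rpow_one]
      rw [ENNReal.tsum_geometric_add_one, ENNReal.one_sub_inv_two, inv_inv,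
        ENNReal.inv_mul_cancel (by simp) (by simp)]
      simp

theorem tendsto_eell_of_finite (hr : 0 < r) {β : Type*} {l : Filter β} (J : Finset ι)
    {f : β → ι → ℝ≥0∞} (hJ : ∀ b, ∀ i ∉ J, f b i = 0)
    (h : ∀ i ∈ J, Tendsto (fun b => f b i) l (𝓝 0)) :
    Tendsto (fun b => eell r (f b)) l (𝓝 0) := by
  by_cases hi : r = ∞
  · have : Tendsto (fun b => ∑ i ∈ J, f b i) l (𝓝 0) := by
      simpa using tendsto_finsetSum J h
    refine tendsto_of_tendsto_of_tendsto_of_le_of_le tendsto_const_nhds this (fun b => zero_le)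
      fun b => ?_
    simp only [hi, eell_top]
    refine iSup_le fun i => ?_
    by_cases hiJ : i ∈ J
    · exact Finset.single_le_sum (f := f b) (fun _ _ => zero_le) hiJ
    · simp [hJ b i hiJ]
  · have hs : 0 < r.toReal := ENNReal.toReal_pos hr.ne' hi
    have h1 : ∀ b, eell r (f b) = (∑ i ∈ J, f b i ^ r.toReal) ^ (1 / r.toReal) := fun b => by
      rw [eell_of_ne_top hi, tsum_eq_sum fun i hiJ => by
        rw [hJ b i hiJ, ENNReal.zero_rpow_of_pos hs]]
    simp only [h1]
    have h0 : ∀ s : ℝ, 0 < s → ∀ g : β → ℝ≥0∞, Tendsto g l (𝓝 0) →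
        Tendsto (fun b => g b ^ s) l (𝓝 0) := fun s hs g hg => by
      simpa [ENNReal.zero_rpow_of_pos hs] using hg.ennrpow_const s
    refine h0 _ (by positivity) _ ?_
    simpa using tendsto_finsetSum J fun i hi => h0 _ hs _ (h i hi)

/-- Dominated convergence in `ℓ_r` (`c₀` if `r = ∞`). -/
theorem tendsto_eell_of_dominated [DecidableEq ι] (hr : 0 < r) {β : Type*} {l : Filter β} {f : β → ι → ℝ≥0∞}
    {g : ι → ℝ≥0∞} (hfg : ∀ b i, f b i ≤ g i) (h : ∀ i, Tendsto (fun b => f b i) l (𝓝 0))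
    (hg : ∀ ε > 0, ∃ J : Finset ι, eell r (fun i => if i ∈ J then 0 else g i) ≤ ε) :
    Tendsto (fun b => eell r (f b)) l (𝓝 0) := by
  rw [ENNReal.tendsto_nhds_zero]
  intro ε hε
  set K := eellConst r
  have hK0 : K ≠ 0 := (zero_lt_one.trans_le one_le_eellConst).ne'
  have hK : 0 < ε / (2 * K) :=
    ENNReal.div_pos hε.ne' (ENNReal.mul_ne_top (by simp) eellConst_ne_top)
  -- The tail condition on `g` replaces finiteness of its norm, which for `r = ∞` would not suffice:
  -- there it is the `c₀` condition.
  obtain ⟨J, hJ⟩ := hg _ hK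
  have h1 : Tendsto (fun b => eell r fun i => if i ∈ J then f b i else 0) l (𝓝 0) := by
    refine tendsto_eell_of_finite hr J (fun b i hi => by simp [hi]) fun i hi => ?_
    simpa [hi] using h i
  filter_upwards [(ENNReal.tendsto_nhds_zero.1 h1) _ hK] with b hb
  calc eell r (f b)
      ≤ eell r (fun i => (if i ∈ J then f b i else 0) + if i ∈ J then 0 else g i) := by
        refine eell_mono fun i => ?_
        split_ifs
        · simp
        · simpa using hfg b i
    _ ≤ K * (ε / (2 * K) + ε / (2 * K)) :=
        (eell_add_le hr _ _).trans (by gcongr)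
    _ = ε := by
        rw [← two_mul, ← mul_assoc, mul_comm K, ENNReal.mul_div_cancel
          (mul_ne_zero two_ne_zero hK0) (ENNReal.mul_ne_top (by simp) eellConst_ne_top)]

/-- The mixed quasi-norm of `ℓ_q(ℓ_p)` for `[0, ∞]`-valued functions. -/
def emix (p q : ℝ≥0∞) (g : ι → κ → ℝ≥0∞) : ℝ≥0∞ := eell q fun j => eell p (g j)

theorem emix_mono {f g : ι → κ → ℝ≥0∞} (h : ∀ j i, f j i ≤ g j i) : emix p q f ≤ emix p q g :=
  eell_mono fun j => eell_mono (h j)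

theorem le_emix (hp : 0 < p) (hq : 0 < q) (g : ι → κ → ℝ≥0∞) (j : ι) (i : κ) :
    g j i ≤ emix p q g :=
  (le_eell hp (g j) i).trans (le_eell hq (fun j => eell p (g j)) j)

/-- A constant in the quasi-triangle inequality of `ℓ_q(ℓ_p)`. -/
def emixConst (p q : ℝ≥0∞) : ℝ≥0∞ := eellConst p * eellConst q

theorem emixConst_ne_top : emixConst p q ≠ ∞ := ENNReal.mul_ne_top eellConst_ne_top eellConst_ne_top

theorem one_le_emixConst : 1 ≤ emixConst p q := one_le_mul one_le_eellConst one_le_eellConst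

theorem emix_add_le (hp : 0 < p) (hq : 0 < q) (f g : ι → κ → ℝ≥0∞) :
    emix p q (fun j i => f j i + g j i) ≤ emixConst p q * (emix p q f + emix p q g) := by
  calc emix p q (fun j i => f j i + g j i)
      ≤ eell q (fun j => eellConst p * (eell p (f j) + eell p (g j))) :=
        eell_mono fun j => eell_add_le hp _ _
    _ = eellConst p * eell q (fun j => eell p (f j) + eell p (g j)) := eell_const_mul hq _ _
    _ ≤ eellConst p * (eellConst q * (emix p q f + emix p q g)) := by
        gcongr
        exact eell_add_le hq _ _
    _ = _ := by rw [emixConst, mul_assoc]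

/-- The mixed quasi-norm of a family of functions which are disjointly supported with respect to
the outer variable. -/
theorem emix_of_disjoint (hp : 0 < p) (hq : 0 < q) {f : κ → ι → ℝ≥0∞}
    (h : ∀ j k l, f k j ≠ 0 → f l j ≠ 0 → k = l) :
    emix p q (fun j k => f k j) = eell q fun k => eell q (f k) := by
  unfold emix
  rw [← eell_comm hq]
  congr 1
  funext j
  exact eell_eq_eell_of_subsingleton hp hq (h j)

end Eell

/-! ### Arrays of nonnegative numbers in `ℓ_q(ℓ_p)` -/

section Arrays

variable {p q r : ℝ≥0∞}

/-- `T m` is equivalent to `m ^ (1 / r)`, for `[0, ∞]`-valued functions. -/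
def IsPowerLike (T : ℕ → ℝ≥0∞) (r : ℝ≥0∞) : Prop :=
  ∃ C : ℝ≥0∞, C ≠ ∞ ∧ ∀ m : ℕ, 1 ≤ m →
    T m ≤ C * (m : ℝ≥0∞) ^ (r⁻¹).toReal ∧ (m : ℝ≥0∞) ^ (r⁻¹).toReal ≤ C * T m

theorem IsPowerLike.of_le_of_le {T : ℕ → ℝ≥0∞} {C c : ℝ≥0∞} (hC : C ≠ ∞) (hc : 0 < c)
    (h₁ : ∀ m : ℕ, 1 ≤ m → T m ≤ (m : ℝ≥0∞) ^ (r⁻¹).toReal * C)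
    (h₂ : ∀ m : ℕ, 1 ≤ m → (m : ℝ≥0∞) ^ (r⁻¹).toReal * c ≤ T m) : IsPowerLike T r := by
  refine ⟨max C c⁻¹, by simp [hC, hc.ne'], fun m hm => ⟨(h₁ m hm).trans ?_, ?_⟩⟩
  · rw [mul_comm]
    gcongr
    exact le_max_left _ _
  -- An infinite `c` would make `T m` infinite, against the upper bound.
  · by_cases hc' : c = ∞
    · have h3 := h₂ m hm
      have hm0 : (m : ℝ≥0∞) ^ (r⁻¹).toReal ≠ 0 :=
        (ENNReal.rpow_pos (by exact_mod_cast hm) (by simp)).ne'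
      rw [hc', ENNReal.mul_top hm0] at h3
      have h4 := h3.trans (h₁ m hm)
      rw [top_le_iff] at h4
      exact absurd h4 (ENNReal.mul_ne_top (ENNReal.rpow_ne_top_of_nonneg (by positivity) (by simp))
        hC)
    · calc (m : ℝ≥0∞) ^ (r⁻¹).toReal = c⁻¹ * ((m : ℝ≥0∞) ^ (r⁻¹).toReal * c) := by
            rw [mul_comm _ c, ← mul_assoc, ENNReal.inv_mul_cancel hc.ne' hc', one_mul]
        _ ≤ _ := mul_le_mul' (le_max_right _ _) (h₂ m hm)

/-- The part of a sequence from the index `N` on. -/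
def tailPart (N : ℕ) (f : ℕ → ℝ≥0∞) (j : ℕ) : ℝ≥0∞ := if N ≤ j then f j else 0

/-- The part of a sequence before the index `N`. -/
def headPart (N : ℕ) (f : ℕ → ℝ≥0∞) (j : ℕ) : ℝ≥0∞ := if N ≤ j then 0 else f j

theorem tailPart_le (N : ℕ) (f : ℕ → ℝ≥0∞) (j : ℕ) : tailPart N f j ≤ f j := by
  unfold tailPart
  split_ifs <;> simp

theorem headPart_add_tailPart (N : ℕ) (f : ℕ → ℝ≥0∞) (j : ℕ) :
    headPart N f j + tailPart N f j = f j := by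
  unfold tailPart headPart
  split_ifs <;> simp

theorem tailPart_anti {M N : ℕ} (h : M ≤ N) (f : ℕ → ℝ≥0∞) (j : ℕ) :
    tailPart N f j ≤ tailPart M f j := by
  unfold tailPart
  split_ifs
  · exact le_rfl
  · omega
  · exact zero_le
  · exact le_rfl

theorem tendsto_eell_headPart (hr : 0 < r) {f : ℕ → ℕ → ℝ≥0∞}
    (h : ∀ j, Tendsto (fun k => f k j) atTop (𝓝 0)) (N : ℕ) :
    Tendsto (fun k => eell r (headPart N (f k))) atTop (𝓝 0) := by
  refine tendsto_eell_of_finite hr (Finset.range N) (fun k j hj => ?_) fun j hj => ?_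
  · rw [Finset.mem_range, not_lt] at hj
    simp [headPart, hj]
  · rw [Finset.mem_range] at hj
    simpa [headPart, not_le.2 hj] using h j

/-- Provides a threshold `η` such that, under a quasi-triangle inequality with constant `K`, two
pieces of size at most `η` cannot add up to a vector of size `c`. -/
theorem exists_pos_mul_add_lt {K c : ℝ≥0∞} (hK : K ≠ ∞) (hc : 0 < c) :
    ∃ η : ℝ≥0∞, 0 < η ∧ K * (η + η) < c := by
  obtain ⟨n, hn, h⟩ := ENNReal.exists_nnreal_pos_mul_lt (a := K * 2)
    (ENNReal.mul_ne_top hK (by simp)) hc.ne'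
  refine ⟨n, by exact_mod_cast hn, ?_⟩
  calc K * ((n : ℝ≥0∞) + n) = n * (K * 2) := by ring
    _ < c := h

/-- The starting index of the `i`-th row block along `φ`. -/
def blockStart (R φ : ℕ → ℕ) : ℕ → ℕ
  | 0 => 0
  | i + 1 => R (φ i)

/-- The column `φ i` vanishes from row `R (φ i)` on, and every later tail starts at or beyond that
row. -/
theorem tailPart_blockStart_disjoint {a : ℕ → ℕ → ℝ≥0∞} {R φ : ℕ → ℕ} (hR : Monotone R)
    (hφ : StrictMono φ) (ha : ∀ k j, R k ≤ j → a k j = 0) {i l j : ℕ}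
    (hi : tailPart (blockStart R φ i) (a (φ i)) j ≠ 0)
    (hl : tailPart (blockStart R φ l) (a (φ l)) j ≠ 0) : i = l := by
  have key : ∀ i l, i < l → tailPart (blockStart R φ i) (a (φ i)) j ≠ 0 →
      tailPart (blockStart R φ l) (a (φ l)) j ≠ 0 → False := by
    intro i l hil hi hl
    obtain ⟨l, rfl⟩ : ∃ l', l = l' + 1 := ⟨l - 1, by omega⟩
    have hi' : a (φ i) j ≠ 0 := fun h0 => hi (by simp [tailPart, h0])
    have hl' : R (φ l) ≤ j := by
      by_contra hj
      exact hl (by simp [tailPart, blockStart, hj])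
    exact hi' (ha _ _ ((hR (hφ.monotone (by omega))).trans hl'))
  rcases lt_trichotomy i l with h | h | h
  · exact (key i l h hi hl).elim
  · exact h
  · exact (key l i h hl hi).elim

theorem emix_tailPart_eq (hp : 0 < p) (hq : 0 < q) {a : ℕ → ℕ → ℝ≥0∞} {R φ : ℕ → ℕ}
    (hR : Monotone R) (hφ : StrictMono φ) (ha : ∀ k j, R k ≤ j → a k j = 0) (m : ℕ) :
    emix p q (fun j (i : Fin m) => tailPart (blockStart R φ i) (a (φ i)) j) =
      eell q fun i : Fin m => eell q (tailPart (blockStart R φ i) (a (φ i))) :=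
  emix_of_disjoint hp hq (f := fun (i : Fin m) => tailPart (blockStart R φ i) (a (φ i)))
    fun _ _ _ hk hl => Fin.ext (tailPart_blockStart_disjoint hR hφ ha hk hl)

/-- Cutting columns down to their tails lowers the norm, and the tails, being in disjoint rows,
combine in `ℓ_q`. -/
theorem le_emix_of_le_eell_tailPart (hp : 0 < p) (hq : 0 < q) {a : ℕ → ℕ → ℝ≥0∞} {R φ : ℕ → ℕ}
    (hR : Monotone R) (hφ : StrictMono φ) (ha : ∀ k j, R k ≤ j → a k j = 0) {c : ℝ≥0∞}
    (hc : ∀ i, c ≤ eell q (tailPart (blockStart R φ i) (a (φ i)))) {m : ℕ} (hm : 1 ≤ m) :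
    (m : ℝ≥0∞) ^ (q⁻¹).toReal * c ≤ emix p q (fun j (i : Fin m) => a (φ i) j) := by
  rw [← eell_fin_const hq hm]
  refine (eell_mono fun i : Fin m => hc i).trans ?_
  rw [← emix_tailPart_eq hp hq hR hφ ha]
  exact emix_mono fun j i => tailPart_le _ _ _

theorem one_le_natCast_rpow {m : ℕ} (hm : 1 ≤ m) {s : ℝ} (hs : 0 ≤ s) : 1 ≤ (m : ℝ≥0∞) ^ s := by
  simpa using ENNReal.rpow_le_rpow (z := s) (show (1 : ℝ≥0∞) ≤ m by exact_mod_cast hm) hs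

/-- A sparse subsequence has negligible heads in the rows used by earlier columns. By Minkowski's
inequality (where `p ≤ q` enters) all heads together contribute at most 1, while the tails lie in
disjoint rows and give exactly the `ℓ_q` combination of their norms. -/
theorem isPowerLike_of_rows_null (hp : 0 < p) (hpq : p ≤ q) {a : ℕ → ℕ → ℝ≥0∞} {R : ℕ → ℕ}
    (hR : Monotone R) (ha : ∀ k j, R k ≤ j → a k j = 0) {c C : ℝ≥0∞} (hC : C ≠ ∞)
    (haC : ∀ k, eell q (a k) ≤ C) (hc : 0 < c) (hac : ∀ k, c ≤ eell q (a k))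
    (hnull : ∀ j, Tendsto (fun k => a k j) atTop (𝓝 0)) :
    ∃ φ : ℕ → ℕ, StrictMono φ ∧
      IsPowerLike (fun m => emix p q fun j (i : Fin m) => a (φ i) j) q := by
  have hq : 0 < q := hp.trans_le hpq
  obtain ⟨η, hη, hηc⟩ := exists_pos_mul_add_lt (eellConst_ne_top (r := q)) hc
  obtain ⟨δ, hδ, hδa, hδ1⟩ := exists_eell_le_one p hp
  -- The bound `η` keeps the tails large; the bound `δ` makes the heads summable in `ℓ_p`. Since `k
  -- ≤ φ k` and `δ` is nonincreasing, `δ (φ i + 1) ≤ δ (i + 1)`.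
  obtain ⟨φ, -, hφ⟩ := exists_seq_of_forall_finset_exists (fun _ : ℕ => True)
    (fun k l => k < l ∧ eell q (headPart (R k) (a l)) ≤ min η (δ (k + 1))) fun s _ => by
      have h : ∀ k ∈ s, ∀ᶠ l in atTop,
          k < l ∧ eell q (headPart (R k) (a l)) ≤ min η (δ (k + 1)) := fun k _ =>
        (eventually_gt_atTop k).and ((ENNReal.tendsto_nhds_zero.1
          (tendsto_eell_headPart hq hnull (R k))) _ (lt_min hη (hδ _)))
      obtain ⟨l, hl⟩ := ((Filter.eventually_all_finset s).2 h).exists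
      exact ⟨l, trivial, hl⟩
  have hmono : StrictMono φ := fun k l hkl => (hφ k l hkl).1
  have hhead : ∀ i, eell q (headPart (blockStart R φ i) (a (φ i))) ≤ min η (δ i) := by
    rintro (_ | i)
    · refine (eell_eq_zero hq fun j => ?_).le.trans zero_le
      simp [headPart, blockStart]
    · refine (hφ i (i + 1) (by omega)).2.trans (min_le_min le_rfl (hδa ?_))
      have := hmono.le_apply (x := i)
      omega
  have htail : ∀ i, η ≤ eell q (tailPart (blockStart R φ i) (a (φ i))) := by
    intro i
    by_contra! h
    refine (hac (φ i)).not_gt (lt_of_le_of_lt ?_ hηc)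
    calc eell q (a (φ i)) = eell q (fun j => headPart (blockStart R φ i) (a (φ i)) j
          + tailPart (blockStart R φ i) (a (φ i)) j) := by simp only [headPart_add_tailPart]
      _ ≤ _ := eell_add_le hq _ _
      _ ≤ _ := by
        gcongr
        exact (hhead i).trans (min_le_left _ _)
  refine ⟨φ, hmono, IsPowerLike.of_le_of_le (C := emixConst p q * (1 + C)) (c := η)
    (ENNReal.mul_ne_top emixConst_ne_top (by simp [hC])) hη (fun m hm => ?_) fun m hm =>
      le_emix_of_le_eell_tailPart hp hq hR hmono ha htail hm⟩
  calc emix p q (fun j (i : Fin m) => a (φ i) j)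
      = emix p q (fun j (i : Fin m) => headPart (blockStart R φ i) (a (φ i)) j
          + tailPart (blockStart R φ i) (a (φ i)) j) := by simp only [headPart_add_tailPart]
    _ ≤ emixConst p q * (emix p q (fun j (i : Fin m) => headPart (blockStart R φ i) (a (φ i)) j)
          + emix p q (fun j (i : Fin m) => tailPart (blockStart R φ i) (a (φ i)) j)) :=
        emix_add_le hp hq _ _
    _ ≤ emixConst p q * ((m : ℝ≥0∞) ^ (q⁻¹).toReal * 1 + (m : ℝ≥0∞) ^ (q⁻¹).toReal * C) := by
        gcongr
        · rw [mul_one]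
          refine le_trans ?_ (one_le_natCast_rpow hm (by positivity))
          refine (eell_eell_le hp hpq
            fun (i : Fin m) => headPart (blockStart R φ i) (a (φ i))).trans ?_
          refine le_trans (eell_mono fun i => (hhead i).trans (min_le_right _ _)) ?_
          exact (eell_comp_le_of_injective Fin.val_injective δ).trans hδ1
        · rw [emix_tailPart_eq hp hq hR hmono ha, ← eell_fin_const hq hm]
          exact eell_mono fun i => (eell_mono fun j => tailPart_le _ _ _).trans (haC _)
    _ = _ := by ring

/-- One row that exceeds `ε` along a subsequence already gives the lower bound; Minkowski's
inequality gives the upper one. -/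
theorem isPowerLike_of_not_null (hp : 0 < p) (hpq : p ≤ q) {a : ℕ → ℕ → ℝ≥0∞}
    {C : ℝ≥0∞} (hC : C ≠ ∞) (haC : ∀ k, eell q (a k) ≤ C) {j : ℕ}
    (hj : ¬ Tendsto (fun k => a k j) atTop (𝓝 0)) :
    ∃ φ : ℕ → ℕ, StrictMono φ ∧
      IsPowerLike (fun m => emix p q fun j (i : Fin m) => a (φ i) j) p := by
  have hq : 0 < q := hp.trans_le hpq
  rw [ENNReal.tendsto_nhds_zero] at hj
  push Not at hj
  obtain ⟨ε, hε, hj⟩ := hj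
  obtain ⟨φ, hφ, h⟩ := extraction_of_frequently_atTop hj
  refine ⟨φ, hφ, IsPowerLike.of_le_of_le hC hε (fun m hm => ?_) fun m hm => ?_⟩
  · refine (eell_eell_le hp hpq fun i : Fin m => a (φ i)).trans ?_
    rw [← eell_fin_const hp hm]
    exact eell_mono fun i => haC _
  · rw [← eell_fin_const hp hm]
    refine (eell_mono fun i : Fin m => (h i).le).trans ?_
    exact le_eell hq (fun j => eell p fun i : Fin m => a (φ i) j) j

/-- Columns can be picked one after another with mass more than `ε` beyond the supports of all
earlier ones, whence the lower bound. For the upper bound, `q ≤ p` lets the inner `ℓ_p` norm be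
replaced by the larger `ℓ_q` norm, and the sums are interchanged. -/
theorem isPowerLike_of_not_tight (hq : 0 < q) (hqp : q ≤ p) {a : ℕ → ℕ → ℝ≥0∞} {R : ℕ → ℕ}
    (hR : Monotone R) (ha : ∀ k j, R k ≤ j → a k j = 0) {c C : ℝ≥0∞} (hC : C ≠ ∞)
    (haC : ∀ k, eell q (a k) ≤ C) (hc : 0 < c) (hac : ∀ k, c ≤ eell q (a k))
    {ε : ℝ≥0∞} (hε : 0 < ε) (h : ∀ N, ∃ k, ε < eell q (tailPart N (a k))) :
    ∃ φ : ℕ → ℕ, StrictMono φ ∧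
      IsPowerLike (fun m => emix p q fun j (i : Fin m) => a (φ i) j) q := by
  have hp : 0 < p := hq.trans_le hqp
  obtain ⟨φ, -, hφ⟩ := exists_seq_of_forall_finset_exists (fun _ : ℕ => True)
    (fun k l => ε < eell q (tailPart (R k) (a l))) fun s _ => by
      obtain ⟨l, hl⟩ := h (s.sup R)
      exact ⟨l, trivial, fun k hk =>
        hl.trans_le (eell_mono fun j => tailPart_anti (Finset.le_sup (f := R) hk) _ _)⟩
  -- If `φ l ≤ φ k`, the column `φ l` would vanish beyond row `R (φ k)`, where its tail has norm
  -- more than `ε`.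
  have hmono : StrictMono φ := fun k l hkl => by
    by_contra! hle
    refine (hφ k l hkl).not_ge ((eell_eq_zero hq fun j => ?_).le.trans zero_le)
    unfold tailPart
    split_ifs with hj
    · exact ha _ _ ((hR hle).trans hj)
    · rfl
  -- The minimum is needed because the first block starts at row 0: it is the whole column, known
  -- only to have norm at least `c`.
  refine ⟨φ, hmono, IsPowerLike.of_le_of_le hC (lt_min hc hε) (fun m hm => ?_) fun m hm =>
    le_emix_of_le_eell_tailPart hp hq hR hmono ha ?_ hm⟩
  · calc emix p q (fun j (i : Fin m) => a (φ i) j)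
        ≤ eell q (fun j => eell q fun i : Fin m => a (φ i) j) :=
          eell_mono fun j => eell_anti hq hqp _
      _ = eell q (fun i : Fin m => eell q (a (φ i))) := eell_comm hq _
      _ ≤ _ := by
          rw [← eell_fin_const hq hm]
          exact eell_mono fun i => haC _
  · rintro (_ | i)
    · refine (min_le_left _ _).trans ((hac (φ 0)).trans (eell_mono fun j => ?_))
      simp [tailPart, blockStart]
    · exact (min_le_right _ _).trans (hφ i (i + 1) (by omega)).le

/-- Tightness makes the `q`-th powers of the columns compact enough in `ℓ_1` for a subsequence to
lie below one fixed vector of `ℓ_q`. Then `m` columns cost at most `m` copies of that vector in each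
row, a factor `m ^ (1/p)`. Tightness also keeps the limit nonzero, and a row where it is nonzero
gives the lower bound. -/
theorem isPowerLike_of_tight (hq : 0 < q) (hqp : q < p) {a : ℕ → ℕ → ℝ≥0∞} {c C : ℝ≥0∞}
    (hC : C ≠ ∞) (haC : ∀ k, eell q (a k) ≤ C) (hc : 0 < c) (hac : ∀ k, c ≤ eell q (a k))
    (htight : ∀ ε > 0, ∃ N, ∀ k, eell q (tailPart N (a k)) ≤ ε) :
    ∃ φ : ℕ → ℕ, StrictMono φ ∧
      IsPowerLike (fun m => emix p q fun j (i : Fin m) => a (φ i) j) p := by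
  have hp : 0 < p := hq.trans hqp
  have hq' : q ≠ ∞ := ne_top_of_lt hqp
  have hs : 0 < q.toReal := ENNReal.toReal_pos hq.ne' hq'
  set s := q.toReal with hs_def
  -- Compactness of the product of copies of `[0, ∞]`. That the limit `α` is finite follows
  -- afterwards from a Fatou argument on finite sums.
  obtain ⟨α, φ, hφ, hlim⟩ := CompactSpace.tendsto_subseq a
  rw [tendsto_pi_nhds] at hlim
  simp only [Function.comp_apply] at hlim
  have hα : ∑' j, α j ^ s ≤ C ^ s := by
    rw [ENNReal.tsum_eq_iSup_sum]
    refine iSup_le fun J => ?_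
    refine le_of_tendsto (tendsto_finsetSum J fun j _ => (hlim j).ennrpow_const s)
      (Eventually.of_forall fun k => ?_)
    refine (ENNReal.sum_le_tsum J).trans ?_
    rw [← eell_rpow hq hq']
    exact ENNReal.rpow_le_rpow (haC _) hs.le
  have hCs : C ^ s ≠ ∞ := ENNReal.rpow_ne_top_of_nonneg hs.le hC
  have hαj : ∀ j, α j ^ s ≠ ∞ := fun j =>
    ne_top_of_le_ne_top hCs ((ENNReal.le_tsum (f := fun j => α j ^ s) j).trans hα)
  obtain ⟨j₀, hj₀⟩ : ∃ j, α j ≠ 0 := by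
    by_contra! h0
    obtain ⟨η, hη, hηc⟩ := exists_pos_mul_add_lt (eellConst_ne_top (r := q)) hc
    obtain ⟨N, hN⟩ := htight η hη
    have hnull : ∀ j, Tendsto (fun k => a (φ k) j) atTop (𝓝 0) := fun j => by
      simpa [h0 j] using hlim j
    obtain ⟨k, hk⟩ := ((ENNReal.tendsto_nhds_zero.1
      (tendsto_eell_headPart hq hnull N)) η hη).exists
    refine (hac (φ k)).not_gt (lt_of_le_of_lt ?_ hηc)
    calc eell q (a (φ k)) = eell q (fun j => headPart N (a (φ k)) j
          + tailPart N (a (φ k)) j) := by simp only [headPart_add_tailPart]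
      _ ≤ _ := eell_add_le hq _ _
      _ ≤ _ := by
        gcongr
        exact hN _
  obtain ⟨ε, hε, hεα⟩ := exists_between (pos_iff_ne_zero.2 hj₀)
  -- Subtraction is truncated, so this controls only the excess of the columns over `α`, which is
  -- all that domination requires.
  have hdiff : Tendsto (fun k => ∑' j, (a (φ k) j ^ s - α j ^ s)) atTop (𝓝 0) := by
    rw [ENNReal.tendsto_nhds_zero]
    intro θ hθ
    obtain ⟨η, hη, hηθ⟩ := exists_pos_mul_add_lt ENNReal.one_ne_top hθ
    rw [one_mul] at hηθ
    -- The minimum with 1 keeps the base finite, since `η = ∞` is not excluded.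
    obtain ⟨N, hN⟩ := htight (min η 1 ^ (1 / s)) (ENNReal.rpow_pos (lt_min hη one_pos) (by simp))
    have hhead : Tendsto (fun k => ∑ j ∈ Finset.range N, (a (φ k) j ^ s - α j ^ s)) atTop
        (𝓝 0) := by
      rw [← Finset.sum_const_zero (s := Finset.range N)]
      refine tendsto_finsetSum _ fun j _ => ?_
      have := ENNReal.Tendsto.sub ((hlim j).ennrpow_const s) tendsto_const_nhds (Or.inl (hαj j))
        (b := α j ^ s)
      rwa [tsub_self] at this
    filter_upwards [(ENNReal.tendsto_nhds_zero.1 hhead) η hη] with k hk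
    calc ∑' j, (a (φ k) j ^ s - α j ^ s)
        ≤ ∑' j, ((if j ∈ Finset.range N then a (φ k) j ^ s - α j ^ s else 0)
            + tailPart N (a (φ k)) j ^ s) := by
          refine ENNReal.tsum_le_tsum fun j => ?_
          by_cases hj : j < N
          · simp [hj]
          · simp [hj, tailPart, not_lt.1 hj]
      _ = ∑ j ∈ Finset.range N, (a (φ k) j ^ s - α j ^ s)
            + eell q (tailPart N (a (φ k))) ^ s := by
          rw [ENNReal.tsum_add, eell_rpow hq hq', tsum_eq_sum (s := Finset.range N)
            fun j hj => by simp only [hj, if_false]]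
          congr 1
          exact Finset.sum_congr rfl fun j hj => by simp only [hj, if_true]
      _ ≤ η + (min η 1 ^ (1 / s)) ^ s := by
          gcongr
          exact hN _
      _ ≤ η + η := by
          rw [← ENNReal.rpow_mul, one_div_mul_cancel hs.ne', ENNReal.rpow_one]
          gcongr
          exact min_le_left _ _
      _ ≤ θ := hηθ.le
  obtain ⟨ψ, hψ, hψd⟩ := extraction_forall_of_eventually (P := fun (n k : ℕ) =>
      ε < a (φ k) j₀ ∧ ∑' j, (a (φ k) j ^ s - α j ^ s) ≤ 2⁻¹ ^ (n + 1)) fun n =>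
    ((hlim j₀).eventually (lt_mem_nhds hεα)).and
      ((ENNReal.tendsto_nhds_zero.1 hdiff) _ (ENNReal.pow_pos (by simp) _))
  -- The common majorant of the `q`-th powers: the limit plus all the excesses, whose total is at
  -- most 1 by the choice of `ψ`.
  set h : ℕ → ℝ≥0∞ := fun j => α j ^ s + ∑' n, (a (φ (ψ n)) j ^ s - α j ^ s) with h_def
  have hsum : ∑' j, h j ≤ C ^ s + 1 := by
    rw [ENNReal.tsum_add, ENNReal.tsum_comm]
    refine add_le_add hα ((ENNReal.tsum_le_tsum fun n => (hψd n).2).trans ?_)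
    rw [ENNReal.tsum_geometric_add_one, ENNReal.one_sub_inv_two, inv_inv,
      ENNReal.inv_mul_cancel (by simp) (by simp)]
  have hle : ∀ n j, a (φ (ψ n)) j ≤ h j ^ (1 / s) := fun n j => by
    calc a (φ (ψ n)) j = (a (φ (ψ n)) j ^ s) ^ (1 / s) := by
          rw [← ENNReal.rpow_mul, mul_one_div_cancel hs.ne', ENNReal.rpow_one]
      _ ≤ _ := by
          gcongr
          refine le_add_tsub.trans (add_le_add le_rfl ?_)
          exact ENNReal.le_tsum (f := fun n => a (φ (ψ n)) j ^ s - α j ^ s) n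
  refine ⟨φ ∘ ψ, hφ.comp hψ, IsPowerLike.of_le_of_le (C := (C ^ s + 1) ^ (1 / s))
    (ENNReal.rpow_ne_top_of_nonneg (by positivity) (by simp [hCs])) hε (fun m hm => ?_)
    fun m hm => ?_⟩
  · calc emix p q (fun j (i : Fin m) => a ((φ ∘ ψ) i) j)
        ≤ eell q (fun j => eell p fun _ : Fin m => h j ^ (1 / s)) :=
          emix_mono fun j i => hle i j
      _ = (m : ℝ≥0∞) ^ (p⁻¹).toReal * eell q (fun j => h j ^ (1 / s)) := by
          simp only [eell_fin_const hp hm]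
          exact eell_const_mul hq _ _
      _ ≤ _ := by
          gcongr
          rw [eell_of_ne_top hq']
          simp only [← ENNReal.rpow_mul, ← hs_def, one_div_mul_cancel hs.ne', ENNReal.rpow_one]
          gcongr
  · rw [← eell_fin_const hp hm]
    refine (eell_mono fun i : Fin m => (hψd i).1.le).trans ?_
    exact le_eell hq (fun j => eell p fun i : Fin m => a ((φ ∘ ψ) i) j) j₀

/-- The growth of the quasi-norms of the sums of a suitable subsequence of a semi-normalized
sequence of finitely supported vectors of `ℓ_q`, put as columns into `ℓ_q(ℓ_p)`. -/
theorem exists_subseq_isPowerLike (hp : 0 < p) (hq : 0 < q) {a : ℕ → ℕ → ℝ≥0∞}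
    (ha : ∀ k, ∃ N, ∀ j, N ≤ j → a k j = 0) {c C : ℝ≥0∞} (hC : C ≠ ∞)
    (haC : ∀ k, eell q (a k) ≤ C) (hc : 0 < c) (hac : ∀ k, c ≤ eell q (a k)) :
    ∃ r, (r = p ∨ r = q) ∧ ∃ φ : ℕ → ℕ, StrictMono φ ∧
      IsPowerLike (fun m => emix p q fun j (i : Fin m) => a (φ i) j) r := by
  choose R₀ hR₀ using ha
  -- Running maxima make the bounds on the supports monotone in the column index.
  have hR : Monotone (partialSups R₀) := (partialSups R₀).monotone
  have ha : ∀ k j, partialSups R₀ k ≤ j → a k j = 0 := fun k j hj =>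
    hR₀ k j ((le_partialSups R₀ k).trans hj)
  rcases le_or_gt p q with hpq | hqp
  · by_cases h : ∀ j, Tendsto (fun k => a k j) atTop (𝓝 0)
    · exact ⟨q, Or.inr rfl, isPowerLike_of_rows_null hp hpq hR ha hC haC hc hac h⟩
    · push Not at h
      obtain ⟨j, hj⟩ := h
      exact ⟨p, Or.inl rfl, isPowerLike_of_not_null hp hpq hC haC hj⟩
  · by_cases h : ∀ ε > 0, ∃ N, ∀ k, eell q (tailPart N (a k)) ≤ ε
    · exact ⟨p, Or.inl rfl, isPowerLike_of_tight hq hqp hC haC hc hac h⟩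
    · push Not at h
      obtain ⟨ε, hε, h⟩ := h
      exact ⟨q, Or.inr rfl, isPowerLike_of_not_tight hq hqp.le hR ha hC haC hc hac hε h⟩

end Arrays

/-! ### The gliding hump in `ℓ_q(ℓ_p)` -/

section GlidingHump

variable {p q r : ℝ≥0∞}

theorem IsPowerLike.of_comparable {S T : ℕ → ℝ≥0∞} {C : ℝ≥0∞} (hT : IsPowerLike T r) (hC : C ≠ ∞)
    (h : ∀ m : ℕ, 1 ≤ m → S m ≤ C * T m ∧ T m ≤ C * S m) : IsPowerLike S r := by
  obtain ⟨D, hD, hT⟩ := hT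
  refine ⟨C * D, ENNReal.mul_ne_top hC hD, fun m hm => ⟨?_, ?_⟩⟩
  · rw [mul_assoc]
    exact (h m hm).1.trans (by gcongr; exact (hT m hm).1)
  · rw [mul_comm C, mul_assoc]
    exact (hT m hm).2.trans (by gcongr; exact (h m hm).2)

/-- Peeling off the first summand repeatedly costs one more factor of the quasi-triangle constant
each time. Perturbations must therefore decay faster than these powers grow. -/
theorem emix_sum_le (hp : 0 < p) (hq : 0 < q) {ι κ : Type*} (n : ℕ) (w : ℕ → ι → κ → ℝ≥0∞) :
    emix p q (fun j l => ∑ i ∈ Finset.range n, w i j l) ≤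
      ∑ i ∈ Finset.range n, emixConst p q ^ (i + 1) * emix p q (w i) := by
  induction n generalizing w with
  | zero =>
    simp only [Finset.range_zero, Finset.sum_empty, nonpos_iff_eq_zero]
    exact eell_eq_zero hq fun _ => eell_eq_zero hp fun _ => rfl
  | succ n ih =>
    simp only [Finset.sum_range_succ']
    refine (emix_add_le hp hq _ _).trans ?_
    rw [mul_add]
    refine add_le_add ?_ (by simp)
    refine (mul_le_mul' le_rfl (ih fun i => w (i + 1))).trans_eq ?_
    rw [Finset.mul_sum]
    exact Finset.sum_congr rfl fun i _ => by ring

theorem tendsto_emix_of_finite (hp : 0 < p) (hq : 0 < q) {ι κ β : Type*} [DecidableEq ι]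
    [DecidableEq κ] {l : Filter β} (F : Finset (ι × κ)) {f : β → ι → κ → ℝ≥0∞}
    (h : ∀ j i, Tendsto (fun b => f b j i) l (𝓝 0)) :
    Tendsto (fun b => emix p q fun j i => if (j, i) ∈ F then f b j i else 0) l (𝓝 0) := by
  refine tendsto_eell_of_finite hq (F.image Prod.fst) (fun b j hj => eell_eq_zero hp fun i => ?_)
    fun j _ => tendsto_eell_of_finite hp (F.image Prod.snd) (fun b i hi => ?_) fun i _ => ?_
  · exact if_neg fun hF => hj (Finset.mem_image_of_mem _ hF)
  · exact if_neg fun hF => hi (Finset.mem_image_of_mem _ hF)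
  · by_cases hF : (j, i) ∈ F <;> simp only [hF, if_true, if_false]
    · exact h j i
    · exact tendsto_const_nhds

theorem enorm_sum_eq_eell {E ι : Type*} [NormedAddCommGroup E] [Fintype ι] (hp : 0 < p) {f : ι → E}
    (h : ∀ i j, f i ≠ 0 → f j ≠ 0 → i = j) : ‖∑ i, f i‖ₑ = eell p fun i => ‖f i‖ₑ := by
  by_cases h0 : ∀ i, f i = 0
  · rw [eell_eq_zero hp fun i => by rw [h0 i, enorm_zero]]
    simp [h0]
  · push Not at h0
    obtain ⟨i, hi⟩ := h0
    have hk : ∀ k, k ≠ i → f k = 0 := fun k hk => by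
      by_contra hne
      exact hk (h k i hne hi)
    rw [eell_eq_of_forall_ne hp i fun k hne => by rw [hk k hne, enorm_zero],
      Finset.sum_eq_single i (fun k _ hne => hk k hne) (by simp)]

/-- Absorption of an error term that is at most half of the left-hand side, in a form that avoids
subtraction. -/
theorem le_two_mul_of_le_add {x y z : ℝ≥0∞} (hx : x ≠ ∞) (h : x ≤ y + z)
    (hz : z + z ≤ x) : x ≤ 2 * y := by
  have h1 : x + x ≤ 2 * y + x := by
    calc x + x ≤ (y + z) + (y + z) := add_le_add h h
      _ = 2 * y + (z + z) := by ring
      _ ≤ 2 * y + x := by gcongr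
  exact (ENNReal.add_le_add_iff_right hx).1 h1

variable {E : Type*} [NormedAddCommGroup E]

/-- The quasi-norm of `ℓ_q(ℓ_p)`, with values in `[0, ∞]`. -/
def emixNorm (p q : ℝ≥0∞) (f : ℕ → ℕ → E) : ℝ≥0∞ := emix p q fun j i => ‖f j i‖ₑ

/-- The vector `f` can be approximated by its restrictions to finite sets. -/
def IsFinitelyApprox (p q : ℝ≥0∞) (f : ℕ → ℕ → E) : Prop :=
  ∀ ε > 0, ∃ F : Finset (ℕ × ℕ),
    emix p q (fun j i => if (j, i) ∈ F then 0 else ‖f j i‖ₑ) ≤ ε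

/-- The quasi-norms of the sums of `m` terms of `y` are equivalent to `Λ m`. -/
def HasSumGrowth (p q : ℝ≥0∞) (y : ℕ → ℕ → ℕ → E) (Λ : ℕ → ℝ≥0∞) : Prop :=
  ∃ C : ℝ≥0∞, C ≠ ∞ ∧ ∀ φ : ℕ → ℕ, StrictMono φ → ∀ m : ℕ, 1 ≤ m →
    emixNorm p q (∑ i : Fin m, y (φ i)) ≤ C * Λ m ∧ Λ m ≤ C * emixNorm p q (∑ i : Fin m, y (φ i))

/-- The finite set to be avoided by the `i`-th block along `φ`. -/
def blockAvoid {α : Type*} (G : ℕ → Finset α) (φ : ℕ → ℕ) : ℕ → Finset α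
  | 0 => ∅
  | i + 1 => G (φ i)

/-- The gliding hump: disjointly supported blocks along a coordinatewise null sequence. -/
theorem exists_disjoint_blocks (hp : 0 < p) (hq : 0 < q) {y : ℕ → ℕ → ℕ → E}
    (happ : ∀ k, IsFinitelyApprox p q (y k))
    (hnull : ∀ j i, Tendsto (fun k => y k j i) atTop (𝓝 0)) {δ : ℕ → ℝ≥0∞} (hδ : ∀ k, 0 < δ k)
    (hδa : Antitone δ) :
    ∃ φ : ℕ → ℕ, StrictMono φ ∧ ∃ u : ℕ → ℕ → ℕ → E,
      (∀ k, emixNorm p q (y (φ k) - u k) ≤ emixConst p q * (δ k + δ k)) ∧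
      (∀ k, ∃ F : Finset (ℕ × ℕ), ∀ j i, (j, i) ∉ F → u k j i = 0) ∧
      ∀ k l j i, u k j i ≠ 0 → u l j i ≠ 0 → k = l := by
  choose F hF using fun k => happ k (δ k) (hδ k)
  set G := partialSups F with hG
  have hFG : ∀ k, F k ⊆ G k := le_partialSups F
  obtain ⟨φ, -, hφ⟩ := exists_seq_of_forall_finset_exists (fun _ : ℕ => True)
    (fun k l => k < l ∧
      emix p q (fun j i => if (j, i) ∈ G k then ‖y l j i‖ₑ else 0) ≤ δ (k + 1)) fun s _ => by
      have h : ∀ k ∈ s, ∀ᶠ l in atTop, k < l ∧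
          emix p q (fun j i => if (j, i) ∈ G k then ‖y l j i‖ₑ else 0) ≤ δ (k + 1) := fun k _ =>
        (eventually_gt_atTop k).and ((ENNReal.tendsto_nhds_zero.1 (tendsto_emix_of_finite hp hq
          (G k) fun j i => by simpa using (hnull j i).enorm)) _ (hδ _))
      obtain ⟨l, hl⟩ := ((Filter.eventually_all_finset s).2 h).exists
      exact ⟨l, trivial, hl⟩
  have hmono : StrictMono φ := fun k l hkl => (hφ k l hkl).1
  have hhead : ∀ k, emix p q
      (fun j i => if (j, i) ∈ blockAvoid G φ k then ‖y (φ k) j i‖ₑ else 0) ≤ δ k := by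
    rintro (_ | k)
    · refine (eell_eq_zero hq fun j => eell_eq_zero hp fun i => ?_).le.trans zero_le
      simp [blockAvoid]
    · refine (hφ k (k + 1) (by omega)).2.trans (hδa ?_)
      have := hmono.le_apply (x := k)
      omega
  have htail : ∀ k, emix p q
      (fun j i => if (j, i) ∈ G (φ k) then 0 else ‖y (φ k) j i‖ₑ) ≤ δ k := fun k => by
    refine le_trans (emix_mono fun j i => ?_) ((hF (φ k)).trans (hδa (hmono.le_apply (x := k))))
    split_ifs with h1 h2 h2
    · exact le_rfl
    · exact zero_le
    · exact absurd (hFG _ h2) h1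
    · exact le_rfl
  -- The block keeps `y (φ k)` on its own essential support minus the supports of all earlier
  -- blocks. What is discarded is a head and a tail, each of norm at most `δ k`.
  refine ⟨φ, hmono, fun k j i => if (j, i) ∈ G (φ k) ∧ (j, i) ∉ blockAvoid G φ k
    then y (φ k) j i else 0, fun k => ?_, fun k => ⟨G (φ k), fun j i h => by simp [h]⟩, ?_⟩
  · refine le_trans (emix_mono fun j i => ?_) ((emix_add_le hp hq
      (fun j i => if (j, i) ∈ blockAvoid G φ k then ‖y (φ k) j i‖ₑ else 0)
      (fun j i => if (j, i) ∈ G (φ k) then 0 else ‖y (φ k) j i‖ₑ)).trans ?_)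
    · simp only [Pi.sub_apply]
      by_cases h1 : (j, i) ∈ G (φ k) <;> by_cases h2 : (j, i) ∈ blockAvoid G φ k <;> simp [h1, h2]
    · gcongr
      · exact hhead k
      · exact htail k
  · have key : ∀ k l j i, k < l → (j, i) ∈ G (φ k) → (j, i) ∈ blockAvoid G φ l := by
      intro k l j i hkl h
      obtain ⟨l, rfl⟩ : ∃ l', l = l' + 1 := ⟨l - 1, by omega⟩
      exact G.monotone (hmono.monotone (by omega : k ≤ l)) h
    intro k l j i hk hl
    have hk' := (ite_ne_right_iff.1 hk).1
    have hl' := (ite_ne_right_iff.1 hl).1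
    rcases lt_trichotomy k l with h | h | h
    · exact absurd (key k l j i h hk'.1) hl'.2
    · exact h
    · exact absurd (key l k j i h hl'.1) hk'.2

theorem emixNorm_add_le (hp : 0 < p) (hq : 0 < q) (f g : ℕ → ℕ → E) :
    emixNorm p q (f + g) ≤ emixConst p q * (emixNorm p q f + emixNorm p q g) :=
  (emix_mono fun _ _ => enorm_add_le _ _).trans (emix_add_le hp hq _ _)

theorem emixNorm_neg (f : ℕ → ℕ → E) : emixNorm p q (-f) = emixNorm p q f := by
  simp [emixNorm]

theorem emixNorm_sum_le (hp : 0 < p) (hq : 0 < q) {v : ℕ → ℕ → ℕ → E} {θ : ℝ≥0∞}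
    (hv : ∀ k, emixConst p q ^ (k + 1) * emixNorm p q (v k) ≤ θ * 2⁻¹ ^ (k + 1)) (m : ℕ) :
    emixNorm p q (∑ i : Fin m, v i) ≤ θ := by
  calc emixNorm p q (∑ i : Fin m, v i)
      ≤ emix p q (fun j l => ∑ i ∈ Finset.range m, ‖v i j l‖ₑ) := by
        refine emix_mono fun j l => ?_
        rw [← Finset.sum_range (fun i => v i), Finset.sum_apply, Finset.sum_apply]
        exact enorm_sum_le _ _
    _ ≤ ∑ i ∈ Finset.range m, emixConst p q ^ (i + 1) * emixNorm p q (v i) :=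
        emix_sum_le hp hq m _
    _ ≤ ∑ i ∈ Finset.range m, θ * 2⁻¹ ^ (i + 1) := Finset.sum_le_sum fun i _ => hv i
    _ ≤ ∑' i : ℕ, θ * 2⁻¹ ^ (i + 1) := ENNReal.sum_le_tsum _
    _ = θ := by
        rw [ENNReal.tsum_mul_left, ENNReal.tsum_geometric_add_one, ENNReal.one_sub_inv_two,
          inv_inv, ENNReal.inv_mul_cancel (by simp) (by simp), mul_one]

/-- At each entry at most one summand is nonzero, so the modulus of the sum is an `ℓ_p` norm over
the summands; within a row this is interchanged with the `ℓ_p` norm over the entries. -/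
theorem emixNorm_sum_of_disjoint (hp : 0 < p) {u : ℕ → ℕ → ℕ → E}
    (hu : ∀ k l j i, u k j i ≠ 0 → u l j i ≠ 0 → k = l) {φ : ℕ → ℕ} (hφ : StrictMono φ) (m : ℕ) :
    emixNorm p q (∑ i : Fin m, u (φ i)) =
      emix p q (fun j (i : Fin m) => eell p fun l => ‖u (φ i) j l‖ₑ) := by
  unfold emixNorm emix
  congr 1
  funext j
  rw [← eell_comm hp]
  congr 1
  funext l
  simp only [Finset.sum_apply]
  exact enorm_sum_eq_eell hp fun i i' h h' =>
    Fin.ext (hφ.injective (hu (φ i) (φ i') j l h h'))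

/-- The growth of sums of a coordinatewise null sequence in `ℓ_q(ℓ_p)`. -/
theorem exists_isPowerLike_of_null (hp : 0 < p) (hq : 0 < q) {y : ℕ → ℕ → ℕ → E}
    (happ : ∀ k, IsFinitelyApprox p q (y k))
    (hnull : ∀ j i, Tendsto (fun k => y k j i) atTop (𝓝 0)) {Λ : ℕ → ℝ≥0∞}
    (hΛ : ∀ m, Λ m ≠ ∞) (hΛ1 : 0 < Λ 1) {D : ℝ≥0∞} (hD : D ≠ ∞)
    (hΛD : ∀ m : ℕ, 1 ≤ m → Λ 1 ≤ D * Λ m) (hy : HasSumGrowth p q y Λ) :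
    ∃ r, (r = p ∨ r = q) ∧ IsPowerLike Λ r := by
  obtain ⟨C, hC, hy⟩ := hy
  set K := emixConst p q with hK
  have hKt : K ≠ ∞ := emixConst_ne_top
  have hK1 : 1 ≤ K := one_le_emixConst
  have hK0 : K ≠ 0 := (zero_lt_one.trans_le hK1).ne'
  have hD0 : D ≠ 0 := by
    rintro rfl
    exact hΛ1.not_ge (by simpa using hΛD 1 le_rfl)
  -- The total perturbation `θ` is chosen below a fixed fraction of every `Λ m`, small enough for
  -- the absorption in `hcomp`.
  obtain ⟨θ, hθ, hθ'⟩ := exists_pos_mul_add_lt (K := D * ((1 + C) * K))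
    (ENNReal.mul_ne_top hD (ENNReal.mul_ne_top (by simp [hC]) hKt)) hΛ1
  have hθΛ : ∀ m, 1 ≤ m → (1 + C) * K * (θ + θ) ≤ Λ m := fun m hm => by
    have h := hθ'.le.trans (hΛD m hm)
    rw [mul_assoc D] at h
    exact (ENNReal.mul_le_mul_iff_right hD0 hD).1 h
  have hθt : θ ≠ ∞ := by
    rintro rfl
    have h := hθΛ 1 le_rfl
    rw [top_add, ENNReal.mul_top (by simp [hK0]), top_le_iff] at h
    exact hΛ 1 h
  have hKi : K * K⁻¹ = 1 := ENNReal.mul_inv_cancel hK0 hKt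
  have h2 : (2⁻¹ : ℝ≥0∞) + 2⁻¹ = 1 := ENNReal.inv_two_add_inv_two
  -- In the exponent `k + 2`, `k + 1` powers of `K⁻¹` cancel the cost of summation and one cancels
  -- the factor in the block error; the spare factor 1/2 pays for `δ k + δ k`.
  obtain ⟨φ, hφ, u, hyu, hfin, hdisj⟩ := exists_disjoint_blocks hp hq happ hnull
    (δ := fun k => θ * (2⁻¹ * K⁻¹) ^ (k + 2))
    (fun k => ENNReal.mul_pos hθ.ne' (ENNReal.pow_pos (ENNReal.mul_pos (by simp)
      (by simpa using hKt)) _).ne')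
    (fun k l hkl => by
      refine mul_le_mul' le_rfl (pow_le_pow_right_of_le_one' ?_ (by omega))
      exact mul_le_one' (by simp) (by simpa using hK1))
  have herr : ∀ ψ : ℕ → ℕ, StrictMono ψ → ∀ m : ℕ,
      emixNorm p q (∑ i : Fin m, (y (φ (ψ i)) - u (ψ i))) ≤ θ := fun ψ hψ m => by
    refine emixNorm_sum_le hp hq (v := fun i => y (φ (ψ i)) - u (ψ i)) (fun k => ?_) m
    have hk : k ≤ ψ k := hψ.le_apply
    calc K ^ (k + 1) * emixNorm p q (y (φ (ψ k)) - u (ψ k))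
        ≤ K ^ (k + 1) * (K * (θ * (2⁻¹ * K⁻¹) ^ (k + 2) + θ * (2⁻¹ * K⁻¹) ^ (k + 2))) := by
          gcongr
          refine (hyu (ψ k)).trans ?_
          have : (2⁻¹ * K⁻¹) ^ (ψ k + 2) ≤ (2⁻¹ * K⁻¹) ^ (k + 2) :=
            pow_le_pow_right_of_le_one' (mul_le_one' (by simp) (by simpa using hK1)) (by omega)
          gcongr
      _ = θ * 2⁻¹ ^ (k + 1) * (K * K⁻¹) ^ (k + 2) * (2⁻¹ + 2⁻¹) := by ring
      _ = _ := by rw [hKi, h2, one_pow, mul_one, mul_one]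
  have hcomp : ∀ ψ : ℕ → ℕ, StrictMono ψ → ∀ m : ℕ, 1 ≤ m →
      emixNorm p q (∑ i : Fin m, u (ψ i)) ≤ K * (C + 1) * Λ m ∧
        Λ m ≤ 2 * (C * K) * emixNorm p q (∑ i : Fin m, u (ψ i)) := fun ψ hψ m hm => by
    obtain ⟨h1, h3⟩ := hy (φ ∘ ψ) (hφ.comp hψ) m hm
    simp only [Function.comp_apply] at h1 h3
    have h4 := herr ψ hψ m
    rw [Finset.sum_sub_distrib] at h4
    have hθm := hθΛ m hm
    constructor
    · calc emixNorm p q (∑ i : Fin m, u (ψ i))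
          = emixNorm p q (∑ i : Fin m, y (φ (ψ i))
              + -(∑ i : Fin m, y (φ (ψ i)) - ∑ i : Fin m, u (ψ i))) := by
            congr 1
            abel
        _ ≤ K * (C * Λ m + θ) := by
            refine (emixNorm_add_le hp hq _ _).trans ?_
            rw [emixNorm_neg]
            gcongr
        _ ≤ K * (C * Λ m + Λ m) := by
            gcongr
            refine le_trans ?_ hθm
            calc θ = 1 * 1 * (θ + 0) := by simp
              _ ≤ (1 + C) * K * (θ + θ) := by
                gcongr
                · exact le_self_add
        _ = _ := by ring
    · rw [mul_assoc 2]
      refine le_two_mul_of_le_add (z := C * K * θ) (hΛ m) ?_ ?_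
      · calc Λ m ≤ C * emixNorm p q (∑ i : Fin m, u (ψ i)
              + (∑ i : Fin m, y (φ (ψ i)) - ∑ i : Fin m, u (ψ i))) := by
              rw [add_sub_cancel]
              exact h3
          _ ≤ C * (K * (emixNorm p q (∑ i : Fin m, u (ψ i)) + θ)) := by
              gcongr
              refine (emixNorm_add_le hp hq _ _).trans ?_
              gcongr
          _ = _ := by ring
      · refine le_trans ?_ hθm
        rw [← mul_add]
        gcongr
        exact le_add_self
  -- The case of one summand, along the shift by `k`, shows that the blocks are semi-normalized.
  have hone : ∀ k, emixNorm p q (u k) ≤ K * (C + 1) * Λ 1 ∧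
      Λ 1 ≤ 2 * (C * K) * emixNorm p q (u k) := fun k => by
    simpa using hcomp (fun i => i + k) (fun a b h => by simpa using h) 1 le_rfl
  have hA : K * (C + 1) ≠ ∞ := ENNReal.mul_ne_top hKt (by simp [hC])
  have hB : 2 * (C * K) ≠ ∞ := ENNReal.mul_ne_top (by simp) (ENNReal.mul_ne_top hC hKt)
  obtain ⟨r, hr, ψ, hψ, hpow⟩ := exists_subseq_isPowerLike hp hq
    (a := fun k j => eell p fun l => ‖u k j l‖ₑ) (c := Λ 1 / (2 * (C * K)))
    (fun k => by
      obtain ⟨F, hF⟩ := hfin k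
      refine ⟨F.sup Prod.fst + 1, fun j hj => eell_eq_zero hp fun i => ?_⟩
      rw [hF j i fun h => ?_, enorm_zero]
      have : j ≤ F.sup Prod.fst := Finset.le_sup (f := Prod.fst) h
      omega)
    (ENNReal.mul_ne_top hA (hΛ 1)) (fun k => (hone k).1) (ENNReal.div_pos hΛ1.ne' hB)
    (fun k => ENNReal.div_le_of_le_mul' (hone k).2)
  refine ⟨r, hr, hpow.of_comparable (C := max (2 * (C * K)) (K * (C + 1))) (by simp [hA, hB])
    fun m hm => ?_⟩
  rw [← emixNorm_sum_of_disjoint hp hdisj hψ]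
  exact ⟨(hcomp ψ hψ m hm).2.trans (by gcongr; exact le_max_left _ _),
    (hcomp ψ hψ m hm).1.trans (by gcongr; exact le_max_right _ _)⟩

end GlidingHump

/-! ### Fundamental functions of symmetric sequence spaces -/

section Symmetric

variable {𝕜 : Type*} [RCLike 𝕜]

/-- The unit vectors of a symmetric sequence space. -/
def SymmetricSeqSpace.unit (S : SymmetricSeqSpace 𝕜) (n : ℕ) : S.carrier :=
  ⟨Pi.single n 1, S.single_mem n⟩

theorem SymmetricSeqSpace.fundamental_eq (S : SymmetricSeqSpace 𝕜) (m : ℕ) :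
    S.fundamental m = S.qnorm (∑ n ∈ Finset.range m, S.unit n) := rfl

theorem SymmetricSeqSpace.coe_sum_apply (S : SymmetricSeqSpace 𝕜) {ι : Type*} (A : Finset ι)
    (s : ι → 𝕜) (e : ι → ℕ) (n : ℕ) :
    ((∑ i ∈ A, s i • S.unit (e i) : S.carrier) : ℕ → 𝕜) n =
      ∑ i ∈ A, if n = e i then s i else 0 := by
  simp [SymmetricSeqSpace.unit, Pi.single_apply]

/-- The permutations of `ℕ` act transitively on injective tuples of any given finite length. -/
theorem exists_perm_apply_eq {ι : Type*} [Fintype ι] {e : ι → ℕ} (he : Function.Injective e) :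
    ∃ π : Equiv.Perm ℕ, ∀ n, π n < Fintype.card ι ↔ ∃ i, e i = n := by
  have := Equiv.Perm.isMultiplyPretransitive ℕ (Fintype.card ι)
  obtain ⟨π, hπ⟩ := this.exists_smul_eq
    ((Fintype.equivFin ι).symm.toEmbedding.trans ⟨e, he⟩) Fin.valEmbedding
  have hπ' : ∀ k : Fin (Fintype.card ι), π (e ((Fintype.equivFin ι).symm k)) = k := fun k =>
    DFunLike.congr_fun hπ k
  refine ⟨π, fun n => ⟨fun hn => ⟨(Fintype.equivFin ι).symm ⟨π n, hn⟩, ?_⟩, ?_⟩⟩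
  · exact π.injective (hπ' ⟨π n, hn⟩)
  · rintro ⟨i, rfl⟩
    have := hπ' (Fintype.equivFin ι i)
    rw [Equiv.symm_apply_apply] at this
    rw [this]
    exact (Fintype.equivFin ι i).2

theorem SymmetricSeqSpace.qnorm_sum (S : SymmetricSeqSpace 𝕜) {ι : Type*} [Fintype ι] {e : ι → ℕ}
    (he : Function.Injective e) {s : ι → 𝕜} (hs : ∀ i, ‖s i‖ = 1) :
    S.qnorm (∑ i, s i • S.unit (e i)) = S.fundamental (Fintype.card ι) := by
  classical
  obtain ⟨π, hπ⟩ := exists_perm_apply_eq he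
  obtain ⟨h, hh⟩ := S.symmetric (∑ n ∈ Finset.range (Fintype.card ι), S.unit n)
    -- The signs are extended by 1 off the range of `e`, as symmetry asks for modulus one at every
    -- coordinate.
    (Function.extend e s 1) π fun n => by
      by_cases hn : ∃ i, e i = n
      · obtain ⟨i, rfl⟩ := hn
        rw [he.extend_apply]
        exact hs i
      · rw [Function.extend_apply' _ _ _ hn]
        simp
  rw [S.fundamental_eq, ← hh]
  congr 1
  refine Subtype.ext (funext fun n => ?_)
  rw [S.coe_sum_apply]
  have h1 := S.coe_sum_apply (Finset.range (Fintype.card ι)) (fun _ => 1) id (π n)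
  simp only [one_smul, id] at h1
  simp only [h1, Finset.sum_ite_eq, Finset.mem_range, hπ n]
  by_cases hn : ∃ i, e i = n
  · obtain ⟨i, rfl⟩ := hn
    simp only [he.extend_apply, he.eq_iff, Finset.sum_ite_eq, Finset.mem_univ, if_true,
      exists_eq, mul_one]
  · rw [if_neg hn, mul_zero]
    exact Finset.sum_eq_zero fun i _ => if_neg fun h => hn ⟨i, h.symm⟩

theorem SymmetricSeqSpace.fundamental_nonneg (S : SymmetricSeqSpace 𝕜) (m : ℕ) :
    0 ≤ S.fundamental m := S.isQuasiBanach.nonneg _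

theorem SymmetricSeqSpace.fundamental_one_pos (S : SymmetricSeqSpace 𝕜) :
    0 < S.fundamental 1 := by
  refine lt_of_le_of_ne (S.fundamental_nonneg 1) fun h => ?_
  rw [S.fundamental_eq, Finset.sum_range_one, eq_comm, S.isQuasiBanach.eq_zero_iff] at h
  have := congrFun (congrArg Subtype.val h) 0
  simp [SymmetricSeqSpace.unit] at this

/-- No lattice property is assumed, so monotonicity comes from signs: the sum of `n` unit vectors,
plus the same sum with signs flipped from index `m` on, is twice the sum of the first `m`. Doubling
is the quasi-triangle inequality for two disjoint groups of `m` unit vectors. -/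
theorem SymmetricSeqSpace.exists_fundamental_le (S : SymmetricSeqSpace 𝕜) :
    ∃ κ : ℝ, 0 ≤ κ ∧ (∀ m n, m ≤ n → S.fundamental m ≤ κ * S.fundamental n) ∧
      ∀ m, S.fundamental (m + m) ≤ κ * S.fundamental m := by
  obtain ⟨κ, hκ⟩ := S.isQuasiBanach.add_le
  have hq : ∀ x, 0 ≤ S.qnorm x := S.isQuasiBanach.nonneg
  refine ⟨2 * max κ 0, by positivity, fun m n hmn => ?_, fun m => ?_⟩
  · have h1 := S.qnorm_sum (e := fun i : Fin n => (i : ℕ)) Fin.val_injective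
      (s := fun i => if (i : ℕ) < m then 1 else -1) fun i => by split_ifs <;> simp
    rw [Finset.sum_range (fun i => (if i < m then (1 : 𝕜) else -1) • S.unit i) |>.symm,
      Fintype.card_fin] at h1
    have h2 := hκ (∑ i ∈ Finset.range n, (if i < m then (1 : 𝕜) else -1) • S.unit i)
      (∑ i ∈ Finset.range n, S.unit i)
    have h3 : ∑ i ∈ Finset.range n, (if i < m then (1 : 𝕜) else -1) • S.unit i +
        ∑ i ∈ Finset.range n, S.unit i = (2 : 𝕜) • ∑ i ∈ Finset.range m, S.unit i := by
      have h : ∀ i, (if i < m then (1 : 𝕜) else -1) • S.unit i + S.unit i =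
          if i < m then (2 : 𝕜) • S.unit i else 0 := fun i => by
        split_ifs
        · rw [one_smul, two_smul]
        · exact Subtype.ext (funext fun n => by simp)
      have hsub : ∑ i ∈ Finset.range m, (if i < m then (2 : 𝕜) • S.unit i else 0) =
          ∑ i ∈ Finset.range n, if i < m then (2 : 𝕜) • S.unit i else 0 :=
        Finset.sum_subset (Finset.range_mono hmn) fun i _ hi => by
          rw [Finset.mem_range] at hi
          rw [if_neg hi]
      rw [← Finset.sum_add_distrib, Finset.smul_sum, Finset.sum_congr rfl fun i _ => h i,
        ← hsub]
      exact Finset.sum_congr rfl fun i hi => if_pos (Finset.mem_range.1 hi)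
    rw [h3, S.isQuasiBanach.smul, h1, ← S.fundamental_eq, ← S.fundamental_eq] at h2
    have h4 : ‖(2 : 𝕜)‖ = 2 := by simp
    rw [h4] at h2
    have h5 : κ * (S.fundamental n + S.fundamental n)
        ≤ max κ 0 * (S.fundamental n + S.fundamental n) :=
      mul_le_mul_of_nonneg_right (le_max_left _ _)
        (add_nonneg (S.fundamental_nonneg n) (S.fundamental_nonneg n))
    nlinarith [mul_nonneg (le_max_right κ 0) (S.fundamental_nonneg n)]
  · rw [S.fundamental_eq, Finset.sum_range_add]
    have h1 := S.qnorm_sum (e := fun i : Fin m => m + (i : ℕ))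
      (fun i j h => Fin.ext (by simpa using h)) (s := fun _ => 1) fun i => by simp
    simp only [one_smul, Fintype.card_fin] at h1
    rw [← Finset.sum_range (fun i => S.unit (m + i))] at h1
    refine (hκ _ _).trans ?_
    rw [h1, ← S.fundamental_eq]
    have h5 : κ * (S.fundamental m + S.fundamental m)
        ≤ max κ 0 * (S.fundamental m + S.fundamental m) :=
      mul_le_mul_of_nonneg_right (le_max_left _ _)
        (add_nonneg (S.fundamental_nonneg m) (S.fundamental_nonneg m))
    linarith

variable {V : Type*} [AddCommGroup V] [Module 𝕜 V] {N : V → ℝ} {x : ℕ → V}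
  {x' : ℕ → V →ₗ[𝕜] 𝕜} {S₁ S₂ : SymmetricSeqSpace 𝕜}

/-- For finitely supported coefficients the partial sums are eventually constant, so the limit `f`
is the finite sum itself because `N` vanishes only at 0. No continuity of `N` is needed. -/
theorem IsSqueezed.exists_sum_le (hN : ∀ v, N v = 0 → v = 0) (h : IsSqueezed N x x' S₁ S₂) :
    ∃ C : ℝ, 0 ≤ C ∧ ∀ (ι : Type) [Fintype ι] (e : ι → ℕ), Function.Injective e → ∀ s : ι → 𝕜,
      (∀ i, ‖s i‖ = 1) → N (∑ i, s i • x (e i)) ≤ C * S₁.fundamental (Fintype.card ι) := by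
  obtain ⟨⟨C, hC⟩, -⟩ := h
  refine ⟨max C 0, le_max_right _ _, fun ι _ e he s hs => ?_⟩
  obtain ⟨f, hf, hfC⟩ := hC (∑ i, s i • S₁.unit (e i))
  have hsum : ∀ k, Finset.univ.sup e < k → ∑ n ∈ Finset.range k,
      ((∑ i, s i • S₁.unit (e i) : S₁.carrier) : ℕ → 𝕜) n • x n = ∑ i, s i • x (e i) := by
    intro k hk
    simp only [S₁.coe_sum_apply, Finset.sum_smul, ite_smul, zero_smul]
    rw [Finset.sum_comm]
    refine Finset.sum_congr rfl fun i _ => ?_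
    rw [Finset.sum_ite_eq', if_pos]
    exact Finset.mem_range.2 ((Finset.le_sup (Finset.mem_univ i)).trans_lt hk)
  have hev : ∀ᶠ k : ℕ in atTop, N (f - ∑ n ∈ Finset.range k,
      ((∑ i, s i • S₁.unit (e i) : S₁.carrier) : ℕ → 𝕜) n • x n) =
        N (f - ∑ i, s i • x (e i)) := by
    filter_upwards [eventually_gt_atTop (Finset.univ.sup e)] with k hk
    rw [hsum k hk]
  have h0 : N (f - ∑ i, s i • x (e i)) = 0 :=
    tendsto_nhds_unique (tendsto_const_nhds.congr' (hev.mono fun _ h => h.symm)) hf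
  rw [← sub_eq_zero.1 (hN _ h0)]
  refine hfC.trans ?_
  rw [S₁.qnorm_sum he hs]
  exact mul_le_mul_of_nonneg_right (le_max_left _ _) (S₁.fundamental_nonneg _)

/-- By biorthogonality the coefficient transform sends the sum to the corresponding signed sum of
unit vectors. -/
theorem IsSqueezed.exists_le_sum (hN : ∀ v, 0 ≤ N v) (hx : IsBiorthogonal N x x')
    (h : IsSqueezed N x x' S₁ S₂) :
    ∃ C : ℝ, 0 ≤ C ∧ ∀ (ι : Type) [Fintype ι] (e : ι → ℕ), Function.Injective e → ∀ s : ι → 𝕜,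
      (∀ i, ‖s i‖ = 1) → S₂.fundamental (Fintype.card ι) ≤ C * N (∑ i, s i • x (e i)) := by
  obtain ⟨-, C, hC⟩ := h
  refine ⟨max C 0, le_max_right _ _, fun ι _ e he s hs => ?_⟩
  obtain ⟨h, hle⟩ := hC (∑ i, s i • x (e i))
  have heq : (⟨_, h⟩ : S₂.carrier) = ∑ i, s i • S₂.unit (e i) := by
    refine Subtype.ext (funext fun n => ?_)
    rw [S₂.coe_sum_apply]
    simp [hx.2]
  rw [heq, S₂.qnorm_sum he hs] at hle
  exact hle.trans (mul_le_mul_of_nonneg_right (le_max_left _ _) (hN _))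

/-- The sums of terms of a squeeze-symmetric sequence grow as the fundamental function of a
symmetric sequence space. -/
theorem IsSqueezeSymmetric.exists_fundamental (hN : ∀ v, 0 ≤ N v) (hN0 : ∀ v, N v = 0 → v = 0)
    (h : IsSqueezeSymmetric 𝕜 N x) :
    ∃ (S : SymmetricSeqSpace 𝕜) (C : ℝ), 0 ≤ C ∧ ∀ (ι : Type) [Fintype ι] (e : ι → ℕ),
      Function.Injective e → ∀ s : ι → 𝕜, (∀ i, ‖s i‖ = 1) →
        N (∑ i, s i • x (e i)) ≤ C * S.fundamental (Fintype.card ι) ∧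
          (1 ≤ Fintype.card ι →
            S.fundamental (Fintype.card ι) ≤ C * N (∑ i, s i • x (e i))) := by
  obtain ⟨x', hx, S₁, S₂, hS, c, C, hc, hC, hcC⟩ := h
  obtain ⟨C₁, hC₁, h₁⟩ := hS.exists_sum_le hN0
  obtain ⟨C₂, hC₂, h₂⟩ := hS.exists_le_sum hN hx
  refine ⟨S₁, max C₁ (C * C₂), le_max_of_le_left hC₁, fun ι _ e he s hs =>
    ⟨(h₁ ι e he s hs).trans ?_, fun hι => ?_⟩⟩
  · exact mul_le_mul_of_nonneg_right (le_max_left _ _) (S₁.fundamental_nonneg _)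
  · calc S₁.fundamental (Fintype.card ι) ≤ C * S₂.fundamental (Fintype.card ι) := (hcC _ hι).2
      _ ≤ C * (C₂ * N (∑ i, s i • x (e i))) := mul_le_mul_of_nonneg_left (h₂ ι e he s hs) hC.le
      _ = C * C₂ * N (∑ i, s i • x (e i)) := by ring
      _ ≤ _ := mul_le_mul_of_nonneg_right (le_max_right _ _) (hN _)

end Symmetric

/-! ### Squeeze-symmetric sequences in `Z_{p,q}` -/

section MatrixSpace

variable {p q r : ℝ≥0∞}

/-- Membership is essential: the real supremum of an unbounded family and the real sum of a
divergent series both default to 0. -/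
theorem ofReal_ellNorm {ι E : Type*} [NormedAddCommGroup E] (hr : 0 < r) {f : ι → E}
    (hf : MemEll r f) : ENNReal.ofReal (ellNorm r f) = eell r fun i => ‖f i‖ₑ := by
  unfold MemEll at hf
  unfold ellNorm eell
  split_ifs at * with hi
  · have h1 : ⨆ i, ‖f i‖ₑ ≤ ENNReal.ofReal (⨆ i, ‖f i‖) := iSup_le fun i => by
      rw [← ofReal_norm]
      exact ENNReal.ofReal_le_ofReal (le_ciSup (bddAbove_of_tendsto hf) i)
    have hB : ⨆ i, ‖f i‖ₑ ≠ ∞ := ne_top_of_le_ne_top ENNReal.ofReal_ne_top h1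
    refine le_antisymm (ENNReal.ofReal_le_of_le_toReal ?_) h1
    refine Real.iSup_le (fun i => ?_) ENNReal.toReal_nonneg
    rw [← toReal_enorm]
    exact ENNReal.toReal_mono hB (le_iSup (fun i => ‖f i‖ₑ) i)
  · have hs : 0 < r.toReal := ENNReal.toReal_pos hr.ne' hi
    rw [← ENNReal.ofReal_rpow_of_nonneg (tsum_nonneg fun i => by positivity) (by positivity),
      ENNReal.ofReal_tsum_of_nonneg (fun i => by positivity) hf]
    congr 1
    refine tsum_congr fun i => ?_
    rw [← ENNReal.ofReal_rpow_of_nonneg (norm_nonneg _) hs.le, ofReal_norm]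

theorem MemEll.exists_eell_compl_le {ι E : Type*} [DecidableEq ι] [NormedAddCommGroup E]
    (hr : 0 < r) {f : ι → E} (hf : MemEll r f) {ε : ℝ≥0∞} (hε : 0 < ε) :
    ∃ J : Finset ι, eell r (fun i => if i ∈ J then 0 else ‖f i‖ₑ) ≤ ε := by
  unfold MemEll at hf
  split_ifs at hf with hi
  · have h : ∀ᶠ i in cofinite, ‖f i‖ₑ ≤ ε := by
      have := hf.enorm
      rw [enorm_zero] at this
      exact (ENNReal.tendsto_nhds_zero.1 this) ε hε
    refine ⟨(show Set.Finite {i | ¬ ‖f i‖ₑ ≤ ε} from h).toFinset, ?_⟩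
    rw [hi, eell_top]
    refine iSup_le fun i => ?_
    split_ifs with h1
    · exact zero_le
    · simpa using h1
  · have hs : 0 < r.toReal := ENNReal.toReal_pos hr.ne' hi
    have hfin : ∑' i, ‖f i‖ₑ ^ r.toReal ≠ ∞ := by
      have := ENNReal.ofReal_tsum_of_nonneg (fun i => by positivity) hf
      simp only [← ENNReal.ofReal_rpow_of_nonneg (norm_nonneg _) hs.le, ofReal_norm] at this
      rw [← this]
      exact ENNReal.ofReal_ne_top
    obtain ⟨J, hJ⟩ := ((ENNReal.tendsto_nhds_zero.1 (ENNReal.tendsto_tsum_compl_atTop_zero hfin))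
      (ε ^ r.toReal) (ENNReal.rpow_pos_of_nonneg hε hs.le)).exists
    refine ⟨J, ?_⟩
    rw [eell_of_ne_top hi]
    calc (∑' i, (if i ∈ J then 0 else ‖f i‖ₑ) ^ r.toReal) ^ (1 / r.toReal)
        = (∑' i : {i // i ∉ J}, ‖f i‖ₑ ^ r.toReal) ^ (1 / r.toReal) := by
          congr 1
          refine (tsum_congr fun i => ?_).trans
            (tsum_subtype {i | i ∉ J} fun i => ‖f i‖ₑ ^ r.toReal).symm
          by_cases h : i ∈ J <;> simp [h, hs]
      _ ≤ (ε ^ r.toReal) ^ (1 / r.toReal) := by gcongr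
      _ = ε := by rw [← ENNReal.rpow_mul, mul_one_div_cancel hs.ne', ENNReal.rpow_one]

variable {𝕜 : Type*} [RCLike 𝕜]

theorem mixedNorm_nonneg {κ : ℕ → Type} (hp : 0 < p) (hq : 0 < q) (f : mixedSpace 𝕜 κ hp hq) :
    0 ≤ mixedNorm 𝕜 hp hq f := ellNorm_nonneg _ _

theorem enorm_ellNorm {ι E : Type*} [NormedAddCommGroup E] (hp : 0 < p) {f : ι → E}
    (hf : MemEll p f) : ‖ellNorm p f‖ₑ = eell p fun i => ‖f i‖ₑ := by
  rw [Real.enorm_of_nonneg (ellNorm_nonneg _ _), ofReal_ellNorm hp hf]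

theorem ofReal_mixedNorm {κ : ℕ → Type} (hp : 0 < p) (hq : 0 < q) (f : mixedSpace 𝕜 κ hp hq) :
    ENNReal.ofReal (mixedNorm 𝕜 hp hq f) = eell q fun n => eell p fun i => ‖f.1 n i‖ₑ := by
  obtain ⟨f, hf⟩ := f
  refine (ofReal_ellNorm hq hf.2).trans ?_
  congr 1
  exact funext fun j => enorm_ellNorm hp (hf.1 j)

theorem ofReal_normZ (hp : 0 < p) (hq : 0 < q) (f : Z 𝕜 hp hq) :
    ENNReal.ofReal (normZ 𝕜 hp hq f) = emixNorm p q (f : ℕ → ℕ → 𝕜) :=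
  ofReal_mixedNorm hp hq f

theorem enorm_coord_le_normZ (hp : 0 < p) (hq : 0 < q) (f : Z 𝕜 hp hq) (j i : ℕ) :
    ‖(f : ℕ → ℕ → 𝕜) j i‖ₑ ≤ ENNReal.ofReal (normZ 𝕜 hp hq f) := by
  rw [ofReal_normZ]
  exact le_emix hp hq (fun j i => ‖(f : ℕ → ℕ → 𝕜) j i‖ₑ) j i

theorem eq_zero_of_normZ_eq_zero (hp : 0 < p) (hq : 0 < q) (f : Z 𝕜 hp hq)
    (h : normZ 𝕜 hp hq f = 0) : f = 0 := by
  refine Subtype.ext (funext fun j => funext fun i => ?_)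
  have := enorm_coord_le_normZ hp hq f j i
  rw [h, ENNReal.ofReal_zero, nonpos_iff_eq_zero, enorm_eq_zero] at this
  exact this

/-- Dominated convergence along growing squares, first within a row and then across the rows. The
`c₀` convention is what makes this true when `p` or `q` is infinite. -/
theorem isFinitelyApprox_coe (hp : 0 < p) (hq : 0 < q) (f : Z 𝕜 hp hq) :
    IsFinitelyApprox p q (f : ℕ → ℕ → 𝕜) := by
  obtain ⟨f, hf⟩ := f
  have h : Tendsto (fun n : ℕ => emix p q fun j i =>
      if (j, i) ∈ Finset.range n ×ˢ Finset.range n then 0 else ‖f j i‖ₑ) atTop (𝓝 0) := by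
    refine tendsto_eell_of_dominated (g := fun j => eell p fun i => ‖f j i‖ₑ) hq
      (fun n j => eell_mono fun i => ?_) (fun j => ?_) fun ε hε => ?_
    · dsimp only
      split_ifs <;> simp
    · refine tendsto_eell_of_dominated (g := fun i => ‖f j i‖ₑ) hp (fun n i => ?_) (fun i => ?_)
        fun ε hε => (hf.1 j).exists_eell_compl_le hp hε
      · dsimp only
        split_ifs <;> simp
      · refine tendsto_const_nhds.congr' ?_
        filter_upwards [eventually_gt_atTop j, eventually_gt_atTop i] with n hj hi
        simp [hj, hi]
    · obtain ⟨J, hJ⟩ := hf.2.exists_eell_compl_le hq hε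
      refine ⟨J, (eell_mono fun j => ?_).trans hJ⟩
      rw [enorm_ellNorm hp (hf.1 j)]
  intro ε hε
  obtain ⟨n, hn⟩ := ((ENNReal.tendsto_nhds_zero.1 h) ε hε).exists
  exact ⟨_, hn⟩

theorem growsAsPower_iff {φ : ℕ → ℝ≥0∞} : GrowsAsPower φ r ↔ IsPowerLike φ r := by
  have hpow : ∀ m : ℕ, 1 ≤ m → ∀ c : ℝ, 0 ≤ c → ENNReal.ofReal (c * (m : ℝ) ^ (r⁻¹).toReal) =
      ENNReal.ofReal c * (m : ℝ≥0∞) ^ (r⁻¹).toReal := fun m hm c hc => by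
    rw [ENNReal.ofReal_mul hc, ← ENNReal.ofReal_rpow_of_nonneg (by positivity) (by positivity),
      ENNReal.ofReal_natCast]
  constructor
  · rintro ⟨c, C, hc, hC, h⟩
    refine IsPowerLike.of_le_of_le (C := ENNReal.ofReal C) (c := ENNReal.ofReal c)
      ENNReal.ofReal_ne_top (ENNReal.ofReal_pos.2 hc) (fun m hm => ?_) fun m hm => ?_
    · rw [mul_comm, ← hpow m hm C hC.le]
      exact (h m hm).2
    · rw [mul_comm, ← hpow m hm c hc.le]
      exact (h m hm).1
  · rintro ⟨C, hC, h⟩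
    have hD : 0 < C.toReal + 1 := by positivity
    have hCD : C ≤ ENNReal.ofReal (C.toReal + 1) := by
      rw [ENNReal.ofReal_add ENNReal.toReal_nonneg zero_le_one, ENNReal.ofReal_toReal hC]
      exact le_self_add
    refine ⟨(C.toReal + 1)⁻¹, C.toReal + 1, by positivity, hD, fun m hm => ⟨?_, ?_⟩⟩
    · rw [hpow m hm _ (by positivity), ENNReal.ofReal_inv_of_pos hD,
        ENNReal.inv_mul_le_iff (ENNReal.ofReal_pos.2 hD).ne' ENNReal.ofReal_ne_top]
      exact (h m hm).2.trans (by gcongr)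
    · rw [hpow m hm _ hD.le]
      exact (h m hm).1.trans (by gcongr)

/-- A countable product of closed balls is compact and metrizable, hence sequentially compact. -/
theorem exists_subseq_tendsto_coord {x : ℕ → ℕ → ℕ → 𝕜} {M : ℝ} (hM : ∀ n j i, ‖x n j i‖ ≤ M) :
    ∃ (L : ℕ → ℕ → 𝕜) (φ : ℕ → ℕ), StrictMono φ ∧
      ∀ j i, Tendsto (fun n => x (φ n) j i) atTop (𝓝 (L j i)) := by
  have hK : IsCompact (Set.univ.pi fun _ : ℕ => Set.univ.pi fun _ : ℕ =>
      Metric.closedBall (0 : 𝕜) M) :=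
    isCompact_univ_pi fun _ => isCompact_univ_pi fun _ => isCompact_closedBall _ _
  obtain ⟨L, -, φ, hφ, h⟩ := hK.tendsto_subseq (x := x) fun n => by
    simpa [Set.mem_pi] using hM n
  refine ⟨L, φ, hφ, fun j i => ?_⟩
  exact tendsto_pi_nhds.1 (tendsto_pi_nhds.1 h j) i

theorem exists_growsAsPower_Z (hp : 0 < p) (hq : 0 < q) {x : ℕ → Z 𝕜 hp hq}
    (hx : IsSqueezeSymmetric 𝕜 (normZ 𝕜 hp hq) x) :
    ∃ r : ℝ≥0∞, (r = p ∨ r = q) ∧ GrowsAsPower (fundamentalFun 𝕜 (normZ 𝕜 hp hq) x) r := by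
  have hN : ∀ v, 0 ≤ normZ 𝕜 hp hq v := mixedNorm_nonneg hp hq
  obtain ⟨S, C, hC, hS⟩ := hx.exists_fundamental hN (eq_zero_of_normZ_eq_zero hp hq)
  obtain ⟨κ, hκ, hmono, hdouble⟩ := S.exists_fundamental_le
  set Λ : ℕ → ℝ≥0∞ := fun m => ENNReal.ofReal (S.fundamental m) with hΛ
  have hxn : ∀ n, normZ 𝕜 hp hq (x n) ≤ C * S.fundamental 1 := fun n => by
    simpa using (hS (Fin 1) (fun _ => n) (Function.injective_of_subsingleton _) (fun _ => 1)
      (by simp)).1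
  obtain ⟨L, φ, hφ, hlim⟩ := exists_subseq_tendsto_coord (x := fun n => (x n : ℕ → ℕ → 𝕜))
    (M := C * S.fundamental 1) fun n j i => by
      have := enorm_coord_le_normZ hp hq (x n) j i
      rw [← ofReal_norm, ENNReal.ofReal_le_ofReal_iff (hN _)] at this
      exact this.trans (hxn n)
  -- Differences of consecutive terms cancel the coordinatewise limit `L`, which need not be zero.
  set y : ℕ → Z 𝕜 hp hq := fun k => x (φ (2 * k)) - x (φ (2 * k + 1)) with hy
  have hnull : ∀ j i, Tendsto (fun k => (y k : ℕ → ℕ → 𝕜) j i) atTop (𝓝 0) := fun j i => by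
    rw [← sub_self (L j i)]
    refine Tendsto.sub ((hlim j i).comp ?_) ((hlim j i).comp ?_)
    · exact tendsto_atTop_mono (fun k => show k ≤ _ by omega) tendsto_id
    · exact tendsto_atTop_mono (fun k => show k ≤ _ by omega) tendsto_id
  have hsum : ∀ ψ : ℕ → ℕ, StrictMono ψ → ∀ m : ℕ, 1 ≤ m →
      normZ 𝕜 hp hq (∑ i : Fin m, y (ψ i)) ≤ C * κ * S.fundamental m ∧
        S.fundamental m ≤ κ * C * normZ 𝕜 hp hq (∑ i : Fin m, y (ψ i)) := by
    intro ψ hψ m hm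
    -- A sum of `m` differences is a signed sum of `2m` distinct terms of `x`.
    have h := hS (Fin m ⊕ Fin m)
      (Sum.elim (fun i => φ (2 * ψ i)) fun i => φ (2 * ψ i + 1)) (by
        refine Function.Injective.sumElim (fun i j h => ?_) (fun i j h => ?_) fun i j h => ?_
        · have := hφ.injective h
          exact Fin.ext (hψ.injective (by omega))
        · have := hφ.injective h
          exact Fin.ext (hψ.injective (by omega))
        · have := hφ.injective h
          omega)
      (Sum.elim (fun _ => 1) fun _ => -1) (by rintro (i | i) <;> simp)
    simp only [Fintype.sum_sum_type, Sum.elim_inl, Sum.elim_inr, one_smul, neg_smul,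
      Finset.sum_neg_distrib, Fintype.card_sum, Fintype.card_fin, ← sub_eq_add_neg] at h
    rw [← Finset.sum_sub_distrib] at h
    constructor
    · refine h.1.trans ?_
      rw [mul_assoc]
      exact mul_le_mul_of_nonneg_left (hdouble m) hC
    · refine (hmono m (m + m) (by omega)).trans ?_
      rw [mul_assoc]
      exact mul_le_mul_of_nonneg_left (h.2 (by omega)) hκ
  have hgrowth : HasSumGrowth p q (fun k => (y k : ℕ → ℕ → 𝕜)) Λ := by
    refine ⟨ENNReal.ofReal (C * κ), ENNReal.ofReal_ne_top, fun ψ hψ m hm => ?_⟩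
    obtain ⟨h1, h2⟩ := hsum ψ hψ m hm
    have e : (∑ i : Fin m, (y (ψ i) : ℕ → ℕ → 𝕜)) =
        ((∑ i : Fin m, y (ψ i) : Z 𝕜 hp hq) : ℕ → ℕ → 𝕜) := by
      rw [AddSubmonoidClass.coe_finsetSum]
    rw [e, ← ofReal_normZ, ← ENNReal.ofReal_mul (mul_nonneg hC hκ),
      ← ENNReal.ofReal_mul (mul_nonneg hC hκ)]
    refine ⟨ENNReal.ofReal_le_ofReal h1, ENNReal.ofReal_le_ofReal ?_⟩
    rwa [mul_comm C]
  obtain ⟨r, hr, hpow⟩ := exists_isPowerLike_of_null hp hq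
    (fun k => isFinitelyApprox_coe hp hq (y k)) hnull (Λ := Λ) (fun m => ENNReal.ofReal_ne_top)
    (ENNReal.ofReal_pos.2 S.fundamental_one_pos) (D := ENNReal.ofReal κ) ENNReal.ofReal_ne_top
    (fun m hm => by
      rw [← ENNReal.ofReal_mul hκ]
      exact ENNReal.ofReal_le_ofReal (hmono 1 m hm)) hgrowth
  have hCκ : C ≤ C * (κ + 1) := by nlinarith
  refine ⟨r, hr, growsAsPower_iff.2 (hpow.of_comparable (C := ENNReal.ofReal (C * (κ + 1)))
    ENNReal.ofReal_ne_top fun m hm => ⟨?_, ?_⟩)⟩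
  · refine iSup_le fun A => iSup_le fun hA => iSup_le fun ε => iSup_le fun hε => ?_
    rw [← ENNReal.ofReal_mul (by positivity)]
    refine ENNReal.ofReal_le_ofReal ?_
    have h := (hS A (fun n => n) Subtype.val_injective (fun n => ε n) fun n => hε n).1
    rw [Finset.sum_coe_sort A fun n => ε n • x n, Fintype.card_coe] at h
    refine h.trans ?_
    rw [mul_assoc]
    refine mul_le_mul_of_nonneg_left ((hmono _ _ hA).trans ?_) hC
    exact mul_le_mul_of_nonneg_right (by linarith) (S.fundamental_nonneg m)
  · have h := (hS (Finset.range m) (fun n => n) Subtype.val_injective (fun _ => 1)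
      fun n => by simp).2 (by simpa using hm)
    rw [Finset.sum_coe_sort (Finset.range m) fun n => (1 : 𝕜) • x n, Fintype.card_coe,
      Finset.card_range] at h
    refine (ENNReal.ofReal_le_ofReal (h.trans
      (mul_le_mul_of_nonneg_right hCκ (hN _)))).trans ?_
    rw [ENNReal.ofReal_mul (by positivity)]
    gcongr
    exact le_iSup_of_le (Finset.range m) (le_iSup_of_le (by simp) (le_iSup_of_le (fun _ => 1)
      (le_iSup_of_le (by simp) le_rfl)))

end MatrixSpace

/-! ### Transfer to complemented subspaces -/

section Transfer

variable {𝕜 V W : Type*} [RCLike 𝕜] [AddCommGroup V] [Module 𝕜 V] [AddCommGroup W] [Module 𝕜 W]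
  {N : V → ℝ} {M : W → ℝ} {J : V →ₗ[𝕜] W} {P : W →ₗ[𝕜] V} {C : ℝ} {r : ℝ≥0∞}

/-- The projection `P` extends the biorthogonal functionals to `W`, and the two symmetric spaces
stay the same. -/
theorem IsSqueezeSymmetric.map (hN : ∀ v, 0 ≤ N v) (hM : ∀ w, 0 ≤ M w) (hC : 0 ≤ C)
    (hJ : ∀ v, M (J v) ≤ C * N v) (hP : ∀ w, N (P w) ≤ C * M w) (hPJ : ∀ v, P (J v) = v)
    {x : ℕ → V} (hx : IsSqueezeSymmetric 𝕜 N x) : IsSqueezeSymmetric 𝕜 M fun n => J (x n) := by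
  obtain ⟨x', hbi, S₁, S₂, ⟨⟨C₁, h₁⟩, C₂, h₂⟩, hc⟩ := hx
  refine ⟨fun n => x' n ∘ₗ P, ⟨fun n => ?_, fun n k => ?_⟩, S₁, S₂,
    ⟨⟨C * C₁, fun a => ?_⟩, max C₂ 0 * C, fun w => ?_⟩, hc⟩
  · obtain ⟨D, hD⟩ := hbi.1 n
    refine ⟨max D 0 * C, fun w => (hD (P w)).trans ?_⟩
    rw [mul_assoc]
    exact mul_le_mul (le_max_left _ _) (hP w) (hN _) (le_max_right _ _)
  · simp only [LinearMap.comp_apply, hPJ, hbi.2]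
  · obtain ⟨f, hf, hfC⟩ := h₁ a
    refine ⟨J f, ?_, ?_⟩
    · refine squeeze_zero (fun k => hM _) (fun k => ?_) (by simpa using hf.const_mul C)
      refine le_trans (le_of_eq ?_) (hJ _)
      simp [map_sum]
    · rw [mul_assoc]
      exact (hJ f).trans (mul_le_mul_of_nonneg_left hfC hC)
  · obtain ⟨h, hle⟩ := h₂ (P w)
    refine ⟨h, hle.trans ?_⟩
    rw [mul_assoc]
    exact mul_le_mul (le_max_left _ _) (hP w) (hN _) (le_max_right _ _)

theorem fundamentalFun_le_of_le (hC : 0 ≤ C) {x : ℕ → V} {y : ℕ → W}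
    (h : ∀ (A : Finset ℕ) (ε : ℕ → 𝕜),
      N (∑ n ∈ A, ε n • x n) ≤ C * M (∑ n ∈ A, ε n • y n)) (m : ℕ) :
    fundamentalFun 𝕜 N x m ≤ ENNReal.ofReal C * fundamentalFun 𝕜 M y m := by
  refine iSup_le fun A => iSup_le fun hA => iSup_le fun ε => iSup_le fun hε => ?_
  refine (ENNReal.ofReal_le_ofReal (h A ε)).trans ?_
  rw [ENNReal.ofReal_mul hC]
  gcongr
  exact le_iSup_of_le A (le_iSup_of_le hA (le_iSup_of_le ε (le_iSup_of_le hε le_rfl)))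

/-- The growth of fundamental functions of squeeze-symmetric sequences passes to complemented
subspaces. -/
theorem IsComplementedIn.exists_growsAsPower {p q : ℝ≥0∞} (hN : ∀ v, 0 ≤ N v)
    (hM : ∀ w, 0 ≤ M w) (h : IsComplementedIn 𝕜 N M)
    (hW : ∀ y : ℕ → W, IsSqueezeSymmetric 𝕜 M y →
      ∃ r : ℝ≥0∞, (r = p ∨ r = q) ∧ GrowsAsPower (fundamentalFun 𝕜 M y) r)
    {x : ℕ → V} (hx : IsSqueezeSymmetric 𝕜 N x) :
    ∃ r : ℝ≥0∞, (r = p ∨ r = q) ∧ GrowsAsPower (fundamentalFun 𝕜 N x) r := by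
  obtain ⟨J, P, C, hJ, hP, hPJ⟩ := h
  have hJ' : ∀ v, M (J v) ≤ max C 0 * N v := fun v =>
    (hJ v).trans (mul_le_mul_of_nonneg_right (le_max_left _ _) (hN _))
  have hP' : ∀ w, N (P w) ≤ max C 0 * M w := fun w =>
    (hP w).trans (mul_le_mul_of_nonneg_right (le_max_left _ _) (hM _))
  obtain ⟨r, hr, hgrow⟩ := hW _ (hx.map hN hM (le_max_right _ _) hJ' hP' hPJ)
  refine ⟨r, hr, growsAsPower_iff.2 ((growsAsPower_iff.1 hgrow).of_comparable
    (C := ENNReal.ofReal (max C 0)) ENNReal.ofReal_ne_top fun m _ => ⟨?_, ?_⟩)⟩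
  · refine fundamentalFun_le_of_le (le_max_right _ _) (fun A ε => ?_) m
    refine le_trans (le_of_eq ?_) (hP' _)
    simp [map_sum, hPJ]
  · refine fundamentalFun_le_of_le (le_max_right _ _) (fun A ε => ?_) m
    refine le_trans (le_of_eq ?_) (hJ' _)
    simp [map_sum]

end Transfer

/-! ### The complemented subspaces `D_{p,q}` and `B_{p,q}` of `Z_{p,q}` -/

section Subspaces

variable {p q r : ℝ≥0∞}

theorem eell_comp_eq_of_injective {ι κ : Type*} (hr : 0 < r) {e : κ → ι}
    (he : Function.Injective e) {f : ι → ℝ≥0∞} (hf : ∀ i, i ∉ Set.range e → f i = 0) :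
    eell r (fun k => f (e k)) = eell r f := by
  refine le_antisymm (eell_comp_le_of_injective he f) ?_
  unfold eell
  split_ifs with hi
  · refine iSup_le fun i => ?_
    by_cases h : i ∈ Set.range e
    · obtain ⟨k, rfl⟩ := h
      exact le_iSup (fun k => f (e k)) k
    · simp [hf i h]
  · have hs : 0 < r.toReal := ENNReal.toReal_pos hr.ne' hi
    refine le_of_eq ?_
    congr 1
    symm
    refine he.tsum_eq (f := fun i => f i ^ r.toReal) fun i h => ?_
    by_contra hne
    exact h (by simp [hf i hne, hs])

theorem memEll_of_finite_support {ι E : Type*} [NormedAddCommGroup E] (hr : 0 < r) {f : ι → E}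
    (J : Finset ι) (h : ∀ i ∉ J, f i = 0) : MemEll r f := by
  unfold MemEll
  split_ifs with hi
  · refine tendsto_const_nhds.congr' ?_
    filter_upwards [J.finite_toSet.compl_mem_cofinite] with i hiJ
    exact (h i hiJ).symm
  · have hs : 0 < r.toReal := ENNReal.toReal_pos hr.ne' hi
    exact summable_of_ne_finset_zero (s := J) fun i hiJ => by
      rw [h i hiJ, norm_zero, Real.zero_rpow hs.ne']

theorem memEll_succ_iff {E : Type*} [NormedAddCommGroup E] {f : ℕ → E} :
    MemEll r (fun n => f (n + 1)) ↔ MemEll r f := by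
  unfold MemEll
  split_ifs with hi
  · rw [Nat.cofinite_eq_atTop]
    exact tendsto_add_atTop_iff_nat 1
  · exact summable_nat_add_iff (f := fun n => ‖f n‖ ^ r.toReal) 1

theorem le_toReal_mul_of_ofReal_le {a b : ℝ} {C : ℝ≥0∞} (hC : C ≠ ∞) (hb : 0 ≤ b)
    (h : ENNReal.ofReal a ≤ C * ENNReal.ofReal b) : a ≤ C.toReal * b := by
  rw [← ENNReal.ofReal_toReal hC, ← ENNReal.ofReal_mul ENNReal.toReal_nonneg] at h
  exact (ENNReal.ofReal_le_ofReal_iff (by positivity)).1 h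

theorem MemEll.norm_apply_le_ellNorm {ι E : Type*} [NormedAddCommGroup E] (hr : 0 < r) {f : ι → E}
    (hf : MemEll r f) (i : ι) : ‖f i‖ ≤ ‖ellNorm r f‖ := by
  rw [← enorm_le_iff_norm_le, enorm_ellNorm hr hf]
  exact le_eell hr (fun i => ‖f i‖ₑ) i

theorem eell_nat_le (hr : 0 < r) (f : ℕ → ℝ≥0∞) :
    eell r f ≤ eellConst r * (f 0 + eell r fun n => f (n + 1)) := by
  have h1 : eell r (fun n => if n = 0 then f n else 0) = f 0 :=
    eell_eq_of_forall_ne hr 0 fun k hk => if_neg hk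
  have h2 : (eell r fun n => f (n + 1)) = eell r fun n => if n = 0 then 0 else f n := by
    refine Eq.trans ?_ (eell_comp_eq_of_injective hr (e := fun n => n + 1)
      (add_left_injective 1) fun i hi => ?_)
    · simp
    · refine if_pos ?_
      by_contra h
      exact hi ⟨i - 1, by dsimp only; omega⟩
  rw [h2]
  rw [← h1]
  refine le_trans (eell_mono fun n => ?_) (eell_add_le hr _ _)
  split_ifs <;> simp

variable (𝕜 : Type*) [RCLike 𝕜]

/-- The matrix with first row `f`, the rest of whose first column is `g`. -/
def hookMatrix {𝕜 : Type*} [RCLike 𝕜] (f g : ℕ → 𝕜) : ℕ → ℕ → 𝕜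
  | 0, i => f i
  | j + 1, i => if i = 0 then g j else 0

variable {𝕜} in
theorem eell_hookMatrix_succ (hp : 0 < p) (f g : ℕ → 𝕜) (j : ℕ) :
    eell p (fun i => ‖hookMatrix f g (j + 1) i‖ₑ) = ‖g j‖ₑ := by
  refine (eell_eq_of_forall_ne hp 0 fun k hk => ?_).trans ?_
  · simp [hookMatrix, hk]
  · simp [hookMatrix]

variable {𝕜} in
theorem hookMatrix_mem (hp : 0 < p) (hq : 0 < q) {f g : ℕ → 𝕜} (hf : MemEll p f)
    (hg : MemEll q g) : hookMatrix f g ∈ Z 𝕜 hp hq := by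
  have hrow : ∀ j, MemEll p (hookMatrix f g j) := by
    rintro (_ | j)
    · exact hf
    · exact memEll_of_finite_support hp {0} fun i hi => if_neg (by simpa using hi)
  refine ⟨hrow, memEll_succ_iff.1 (hg.of_le hq fun j => ?_)⟩
  rw [← enorm_le_iff_norm_le, enorm_ellNorm hp (hrow (j + 1)), eell_hookMatrix_succ hp]

/-- The embedding of `D_{p,q}` into `Z_{p,q}`. -/
def embD (hp : 0 < p) (hq : 0 < q) : D 𝕜 hp hq →ₗ[𝕜] Z 𝕜 hp hq where
  toFun f := ⟨hookMatrix f.1.1 f.1.2, hookMatrix_mem hp hq f.2.1 f.2.2⟩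
  map_add' f g := by
    refine Subtype.ext (funext fun j => funext fun i => ?_)
    cases j with
    | zero => rfl
    | succ j =>
      change (if i = 0 then f.1.2 j + g.1.2 j else 0) =
        (if i = 0 then f.1.2 j else 0) + (if i = 0 then g.1.2 j else 0)
      split_ifs <;> simp
  map_smul' c f := by
    refine Subtype.ext (funext fun j => funext fun i => ?_)
    cases j with
    | zero => rfl
    | succ j =>
      change (if i = 0 then c * f.1.2 j else 0) = c * (if i = 0 then f.1.2 j else 0)
      split_ifs <;> simp

/-- The projection of `Z_{p,q}` onto `D_{p,q}`. -/
def projD (hp : 0 < p) (hq : 0 < q) : Z 𝕜 hp hq →ₗ[𝕜] D 𝕜 hp hq where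
  toFun h := ⟨(h.1 0, fun j => h.1 (j + 1) 0), h.2.1 0, (memEll_succ_iff.2 h.2.2).of_le hq
    fun j => (h.2.1 (j + 1)).norm_apply_le_ellNorm hp 0⟩
  map_add' _ _ := rfl
  map_smul' _ _ := rfl

theorem normD_nonneg (hp : 0 < p) (hq : 0 < q) (f : D 𝕜 hp hq) : 0 ≤ normD 𝕜 hp hq f :=
  le_max_of_le_left (ellNorm_nonneg _ _)

/-- The first row of a matrix carries `ℓ_p`, and the entries of the first column below it carry
`ℓ_q`, each being at most the norm of its row. The constant comes from splitting off row 0 and from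
bounding a sum by twice a maximum. -/
theorem isComplementedIn_normD (hp : 0 < p) (hq : 0 < q) :
    IsComplementedIn 𝕜 (normD 𝕜 hp hq) (normZ 𝕜 hp hq) := by
  have hC : eellConst q * 2 ≠ ∞ := ENNReal.mul_ne_top eellConst_ne_top (by simp)
  have hC1 : 1 ≤ eellConst q * 2 := one_le_mul one_le_eellConst one_le_two
  refine ⟨embD 𝕜 hp hq, projD 𝕜 hp hq, (eellConst q * 2).toReal, fun f => ?_, fun h => ?_,
    fun f => Subtype.ext (Prod.ext rfl (funext fun j => ?_))⟩
  · refine le_toReal_mul_of_ofReal_le hC (normD_nonneg 𝕜 hp hq f) ?_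
    rw [ofReal_normZ]
    refine (eell_nat_le hq _).trans ?_
    rw [mul_assoc, two_mul]
    gcongr
    · exact (ofReal_ellNorm hp f.2.1).symm.trans_le (ENNReal.ofReal_le_ofReal (le_max_left _ _))
    · refine le_trans (le_of_eq ?_)
        ((ofReal_ellNorm hq f.2.2).symm.trans_le (ENNReal.ofReal_le_ofReal (le_max_right _ _)))
      congr 1
      exact funext fun j => eell_hookMatrix_succ hp f.1.1 f.1.2 j
  · refine le_toReal_mul_of_ofReal_le hC (mixedNorm_nonneg hp hq h) ?_
    refine le_trans ?_ (le_mul_of_one_le_left zero_le hC1)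
    rw [ofReal_normZ, normD, ENNReal.ofReal_max]
    refine max_le ?_ ?_
    · rw [ofReal_ellNorm hp (projD 𝕜 hp hq h).2.1]
      exact le_eell hq (fun j => eell p fun i => ‖h.1 j i‖ₑ) 0
    · rw [ofReal_ellNorm hq (projD 𝕜 hp hq h).2.2]
      refine le_trans (eell_mono fun j => ?_) (eell_comp_le_of_injective (add_left_injective 1)
        fun j => eell p fun i => ‖h.1 j i‖ₑ)
      exact le_eell hp (fun i => ‖h.1 (j + 1) i‖ₑ) 0
  · change (if (0 : ℕ) = 0 then f.1.2 j else 0) = f.1.2 j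
    exact if_pos rfl

/-- The extension by zero of a triangular array to a matrix. -/
def triangleMatrix {𝕜 : Type*} [RCLike 𝕜] (f : (n : ℕ) → Fin (n + 1) → 𝕜) (n i : ℕ) : 𝕜 :=
  if h : i < n + 1 then f n ⟨i, h⟩ else 0

variable {𝕜} in
theorem eell_triangleMatrix (hp : 0 < p) (f : (n : ℕ) → Fin (n + 1) → 𝕜) (n : ℕ) :
    eell p (fun i => ‖triangleMatrix f n i‖ₑ) = eell p fun i => ‖f n i‖ₑ := by
  rw [← eell_comp_eq_of_injective hp (e := fun i : Fin (n + 1) => (i : ℕ)) Fin.val_injective]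
  · congr 1
    funext i
    rw [triangleMatrix, dif_pos i.2]
  · intro i hi
    rw [triangleMatrix, dif_neg, enorm_zero]
    exact fun h => hi ⟨⟨i, h⟩, rfl⟩

variable {𝕜} in
theorem triangleMatrix_mem (hp : 0 < p) (hq : 0 < q) {f : (n : ℕ) → Fin (n + 1) → 𝕜}
    (hf : f ∈ B 𝕜 hp hq) : triangleMatrix f ∈ Z 𝕜 hp hq := by
  have hrow : ∀ n, MemEll p (triangleMatrix f n) := fun n =>
    memEll_of_finite_support hp (Finset.range (n + 1)) fun i hi => dif_neg (by simpa using hi)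
  refine ⟨hrow, hf.2.of_le hq fun n => ?_⟩
  rw [← enorm_le_iff_norm_le, enorm_ellNorm hp (hrow n), enorm_ellNorm hp (hf.1 n),
    eell_triangleMatrix hp]

/-- The embedding of `B_{p,q}` into `Z_{p,q}`. -/
def embB (hp : 0 < p) (hq : 0 < q) : B 𝕜 hp hq →ₗ[𝕜] Z 𝕜 hp hq where
  toFun f := ⟨triangleMatrix f.1, triangleMatrix_mem hp hq f.2⟩
  map_add' f g := by
    refine Subtype.ext (funext fun n => funext fun i => ?_)
    change triangleMatrix (f.1 + g.1) n i = triangleMatrix f.1 n i + triangleMatrix g.1 n i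
    unfold triangleMatrix
    split_ifs <;> simp
  map_smul' c f := by
    refine Subtype.ext (funext fun n => funext fun i => ?_)
    change triangleMatrix (c • f.1) n i = c * triangleMatrix f.1 n i
    unfold triangleMatrix
    split_ifs <;> simp

variable {𝕜} in
theorem ellNorm_restrict_le (hp : 0 < p) {f : ℕ → 𝕜} (hf : MemEll p f) (n : ℕ) :
    ‖ellNorm p fun i : Fin (n + 1) => f i‖ₑ ≤ ‖ellNorm p f‖ₑ := by
  rw [enorm_ellNorm hp (memEll_of_finite_support hp Finset.univ (by simp)), enorm_ellNorm hp hf]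
  exact eell_comp_le_of_injective Fin.val_injective fun i => ‖f i‖ₑ

/-- The projection of `Z_{p,q}` onto `B_{p,q}`. -/
def projB (hp : 0 < p) (hq : 0 < q) : Z 𝕜 hp hq →ₗ[𝕜] B 𝕜 hp hq where
  toFun h := ⟨fun n i => h.1 n i, fun n => memEll_of_finite_support hp Finset.univ (by simp),
    h.2.2.of_le hq fun n => enorm_le_iff_norm_le.1 (ellNorm_restrict_le hp (h.2.1 n) n)⟩
  map_add' _ _ := rfl
  map_smul' _ _ := rfl

/-- Padding rows with zeros preserves their norms and truncating rows does not increase them, so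
both maps have constant 1. -/
theorem isComplementedIn_normB (hp : 0 < p) (hq : 0 < q) :
    IsComplementedIn 𝕜 (normB 𝕜 hp hq) (normZ 𝕜 hp hq) := by
  refine ⟨embB 𝕜 hp hq, projB 𝕜 hp hq, (1 : ℝ≥0∞).toReal, fun f => ?_, fun h => ?_, fun f => ?_⟩
  · refine le_toReal_mul_of_ofReal_le ENNReal.one_ne_top (mixedNorm_nonneg hp hq f) ?_
    rw [one_mul, ofReal_mixedNorm, ofReal_mixedNorm]
    exact eell_mono fun n => (eell_triangleMatrix hp f.1 n).le
  · refine le_toReal_mul_of_ofReal_le ENNReal.one_ne_top (mixedNorm_nonneg hp hq h) ?_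
    rw [one_mul, ofReal_mixedNorm, ofReal_mixedNorm]
    exact eell_mono fun n =>
      eell_comp_le_of_injective Fin.val_injective fun i => ‖h.1 n i‖ₑ
  · refine Subtype.ext (funext fun n => funext fun i => ?_)
    exact dif_pos i.2

end Subspaces

end SqueezeSym

end

theorem theorem5p8 (𝕜 : Type*) [RCLike 𝕜] (p q : ℝ≥0∞) (hp : 0 < p) (hq : 0 < q) :
    (∀ x : ℕ → SqueezeSym.Z 𝕜 hp hq,
      SqueezeSym.IsSqueezeSymmetric 𝕜 (SqueezeSym.normZ 𝕜 hp hq) x →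
        ∃ r : ℝ≥0∞, (r = p ∨ r = q) ∧
          SqueezeSym.GrowsAsPower
            (SqueezeSym.fundamentalFun 𝕜 (SqueezeSym.normZ 𝕜 hp hq) x) r) ∧
    (SqueezeSym.IsComplementedIn 𝕜 (SqueezeSym.normD 𝕜 hp hq) (SqueezeSym.normZ 𝕜 hp hq) ∧
      ∀ x : ℕ → SqueezeSym.D 𝕜 hp hq,
        SqueezeSym.IsSqueezeSymmetric 𝕜 (SqueezeSym.normD 𝕜 hp hq) x →
          ∃ r : ℝ≥0∞, (r = p ∨ r = q) ∧
            SqueezeSym.GrowsAsPower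
              (SqueezeSym.fundamentalFun 𝕜 (SqueezeSym.normD 𝕜 hp hq) x) r) ∧
    (SqueezeSym.IsComplementedIn 𝕜 (SqueezeSym.normB 𝕜 hp hq) (SqueezeSym.normZ 𝕜 hp hq) ∧
      ∀ x : ℕ → SqueezeSym.B 𝕜 hp hq,
        SqueezeSym.IsSqueezeSymmetric 𝕜 (SqueezeSym.normB 𝕜 hp hq) x →
          ∃ r : ℝ≥0∞, (r = p ∨ r = q) ∧
            SqueezeSym.GrowsAsPower
              (SqueezeSym.fundamentalFun 𝕜 (SqueezeSym.normB 𝕜 hp hq) x) r) := by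
  have hZ : ∀ x : ℕ → SqueezeSym.Z 𝕜 hp hq,
      SqueezeSym.IsSqueezeSymmetric 𝕜 (SqueezeSym.normZ 𝕜 hp hq) x →
        ∃ r : ℝ≥0∞, (r = p ∨ r = q) ∧
          SqueezeSym.GrowsAsPower
            (SqueezeSym.fundamentalFun 𝕜 (SqueezeSym.normZ 𝕜 hp hq) x) r :=
    fun _ hx => SqueezeSym.exists_growsAsPower_Z hp hq hx
  refine ⟨hZ, ⟨SqueezeSym.isComplementedIn_normD 𝕜 hp hq, fun x hx => ?_⟩,
    SqueezeSym.isComplementedIn_normB 𝕜 hp hq, fun x hx => ?_⟩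
  · exact (SqueezeSym.isComplementedIn_normD 𝕜 hp hq).exists_growsAsPower
      (SqueezeSym.normD_nonneg 𝕜 hp hq) (SqueezeSym.mixedNorm_nonneg hp hq) hZ hx
  · exact (SqueezeSym.isComplementedIn_normB 𝕜 hp hq).exists_growsAsPower
      (SqueezeSym.mixedNorm_nonneg hp hq) (SqueezeSym.mixedNorm_nonneg hp hq) hZ hx
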